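/- For a modulus $k\in(0,1)$ let $k'=\sqrt{1-k^2}$ and let $K(k)=\int_0^{\pi/2}\frac{d\varphi}{\sqrt{1-k^2\sin^2\varphi}}$ be the complete elliptic integral of the first kind. Let $\alpha>\frac{\ln 2}{\pi}$. Then there is exactly one $k\in(0,1)$ with $\frac{K(k')}{K(k)}=\alpha$, and for this $k$, with $K=K(k)$, $$\int_0^{\pi/2}\frac{\cosh\frac{x}{2\alpha}\,\cos\frac{\ln(2\cos x)}{2\alpha}}{\cosh\frac{x}{\alpha}+\cos\frac{\ln(2\cos x)}{\alpha}}\,dx=\frac{\pi}{8}(\alpha+2)-\frac{\alpha}{4}K,$$ where the integrand is integrable on $[0,\pi/2]$. -/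

import Mathlib

/-- The complete elliptic integral of the first kind
`K(k) = ∫₀^{π/2} dφ / √(1 - k² sin² φ)`, as a function of the modulus `k`
(to be used for `0 < k < 1`, where the integrand is continuous). -/
noncomputable def ellipticK (k : ℝ) : ℝ :=
  ∫ φ in (0 : ℝ)..(Real.pi / 2), 1 / Real.sqrt (1 - k ^ 2 * Real.sin φ ^ 2)

/-- The complementary modulus `k' = √(1 - k²)`. -/
noncomputable def complementaryModulus (k : ℝ) : ℝ :=
  Real.sqrt (1 - k ^ 2)

/-- `k` is the elliptic modulus belonging to the parameter `α`:
`0 < k < 1` and `α = K' / K`, where `K = K(k)` and `K' = K(k')`. -/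
def IsModulusFor (α k : ℝ) : Prop :=
  0 < k ∧ k < 1 ∧ α = ellipticK (complementaryModulus k) / ellipticK k

/-! Put `u = e^{2ix}` and `f(u) = cos(log(1+u)/(2α))`. Since `1 + u = 2 cos x · e^{ix}`, the
integrand is half the real part of `1/f(u)`, and by the symmetry `x ↦ π - x` the integral is `π/4`
times the mean of `1/f` over the unit circle. The zeros of `f` have `log(1+u) = (2k+1)πα`. Because
`α > ln 2/π`, those with `k ≥ 0` have `|1+u| > 2` and lie outside the disc; the others are simple,
lie in the disc, and accumulate at `-1`. Circles passing between them have means given by residues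
(`circleAverage_inv_cosLog`), and a uniform lower bound for `|f|` on these circles
(`exists_le_norm_sq_cosLog`) lets the radius tend to 1. The mean is `1 - 2α ∑ (-1)^n/(e^{πα(2n+1)} -
1)`, a Lambert series for `∑ sech(mπα)`.

It remains to show `∑ sech(mπα) = 2K/π`. Write `a, b, c` for `sechSum`, `altSechSum`, `halfSechSum`;
classically these are `θ₃², θ₄², θ₂²` at nome `e^{-t}`. Doubling `t` is one step of the
arithmetic-geometric mean: `a(2t) = (a+b)/2`, `b(2t)² = ab`. Gauss's transformation preserves the
symmetric elliptic integral `I(a,b)`, and `a, b → 1` as `t → ∞`, so `I(a,b) = π/2`. With `a² = b² +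
c²` the modulus `k = c/a` has `K = πa/2`. Poisson summation exchanges `b` and `c` under `t ↦ π²/t`,
which gives `K'/K = t/π = α`. Uniqueness of `k` is the strict monotonicity of `K'/K`. -/

open MeasureTheory Filter Asymptotics Set
open scoped Topology

/-! ### Sech series and their convergence -/

/-- `∑ sech (m t)` over the integers. -/
noncomputable def sechSum (t : ℝ) : ℝ := ∑' m : ℤ, (Real.cosh (m * t))⁻¹

/-- `∑ (-1)^m sech (m t)` over the integers. -/
noncomputable def altSechSum (t : ℝ) : ℝ := ∑' m : ℤ, (-1 : ℝ) ^ m * (Real.cosh (m * t))⁻¹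

/-- `∑ sech ((m + 1/2) t)` over the integers. -/
noncomputable def halfSechSum (t : ℝ) : ℝ := ∑' m : ℤ, (Real.cosh ((m + 1 / 2) * t))⁻¹

lemma inv_cosh_le_two_mul_exp_neg (x : ℝ) : (Real.cosh x)⁻¹ ≤ 2 * Real.exp (-x) := by
  rw [inv_le_iff_one_le_mul₀ (Real.cosh_pos x), Real.cosh_eq]
  have h : Real.exp (-x) * Real.exp x = 1 := by rw [← Real.exp_add]; simp
  nlinarith [Real.exp_pos (-x)]

lemma inv_cosh_le_four_div_sq {x : ℝ} (hx : x ≠ 0) : (Real.cosh x)⁻¹ ≤ 4 / x ^ 2 := by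
  have h := Real.quadratic_le_exp_of_nonneg (abs_nonneg x)
  have h2 : x ^ 2 / 4 ≤ Real.cosh x := by
    rw [← Real.cosh_abs, Real.cosh_eq]
    have := Real.exp_pos (-|x|)
    nlinarith [sq_abs x, abs_nonneg x]
  have h3 : 0 < x ^ 2 / 4 := by positivity
  calc (Real.cosh x)⁻¹ ≤ (x ^ 2 / 4)⁻¹ := inv_anti₀ h3 h2
    _ = 4 / x ^ 2 := by rw [inv_div]

/-- Exponential decay is weakened to a power above 1, the form in which Poisson summation asks for
it; it also gives summability over the integers. -/
lemma inv_cosh_isBigO_cocompact {s : ℝ} (hs : s ≠ 0) :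
    (fun x : ℝ => (((Real.cosh (s * x))⁻¹ : ℝ) : ℂ)) =O[cocompact ℝ]
      fun x : ℝ => |x| ^ (-2 : ℝ) := by
  refine IsBigO.of_bound (4 / s ^ 2) ?_
  have : ∀ᶠ x : ℝ in cocompact ℝ, x ≠ 0 := by
    have := (isCompact_singleton (x := (0 : ℝ))).compl_mem_cocompact
    filter_upwards [this] with x hx using hx
  filter_upwards [this] with x hx
  have h := inv_cosh_le_four_div_sq (mul_ne_zero hs hx)
  rw [Complex.norm_real, Real.norm_of_nonneg (by positivity), Real.norm_of_nonneg (by positivity)]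
  calc _ ≤ _ := h
    _ = _ := by
      rw [Real.rpow_neg (abs_nonneg x), Real.rpow_two, sq_abs]
      field_simp

lemma summable_inv_cosh {t : ℝ} (ht : t ≠ 0) :
    Summable fun m : ℤ => (Real.cosh (m * t))⁻¹ := by
  have h := (inv_cosh_isBigO_cocompact ht).comp_tendsto Int.tendsto_coe_cofinite
  have h2 := summable_of_isBigO (Real.summable_abs_int_rpow one_lt_two) h
  have h3 := Complex.summable_ofReal.mp h2
  simpa [mul_comm] using h3

lemma summable_alt_inv_cosh {t : ℝ} (ht : t ≠ 0) :
    Summable fun m : ℤ => (-1 : ℝ) ^ m * (Real.cosh (m * t))⁻¹ := by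
  refine Summable.of_norm ?_
  refine (summable_inv_cosh ht).congr fun m => ?_
  rw [norm_mul, norm_zpow, norm_neg, norm_one, one_zpow, one_mul,
    Real.norm_of_nonneg (by positivity)]

/-! ### Fourier transform of sech and Poisson duality -/

/-- Substitute `x = sigmoid y`: then `dx = x(1-x) dy`, `x/(1-x) = e^y` and `√(x(1-x)) = 1/(2
cosh(y/2))`. -/
lemma betaIntegral_eq_integral_inv_cosh (ξ : ℝ) :
    Complex.betaIntegral (1 / 2 - ξ * Complex.I) (1 / 2 + ξ * Complex.I) =
      ∫ y : ℝ, Complex.exp (-(ξ * y) * Complex.I) * (((2 * Real.cosh (y / 2))⁻¹ : ℝ) : ℂ) := by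
  rw [Complex.betaIntegral, intervalIntegral.integral_of_le zero_le_one,
    ← integral_Ioc_eq_integral_Ioo.symm, ← Real.range_sigmoid, ← image_univ,
    integral_image_eq_integral_abs_deriv_smul MeasurableSet.univ
      (fun x _ => (Real.hasDerivAt_sigmoid x).hasDerivWithinAt) Real.sigmoid_injective.injOn,
    Measure.restrict_univ]
  refine integral_congr_ae (Eventually.of_forall fun y => ?_)
  have hx0 := Real.sigmoid_pos y
  have hx1 : 0 < 1 - Real.sigmoid y := sub_pos.2 (Real.sigmoid_lt_one y)
  have hl1 : Real.log (Real.sigmoid y) = -Real.log (1 + Real.exp (-y)) := by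
    rw [Real.sigmoid_def, Real.log_inv]
  have hl2 : Real.log (1 - Real.sigmoid y) = -y - Real.log (1 + Real.exp (-y)) := by
    rw [← Real.sigmoid_neg, ← Real.sigmoid_mul_rexp_neg, Real.log_mul hx0.ne' (Real.exp_ne_zero _),
      Real.log_exp, hl1]; ring
  have key : (2 * Real.cosh (y / 2))⁻¹ = Real.exp (-y / 2 - Real.log (1 + Real.exp (-y))) := by
    rw [sub_eq_add_neg, Real.exp_add, Real.exp_neg (Real.log _), Real.exp_log (by positivity),
      Real.cosh_eq, inv_eq_iff_eq_inv, mul_inv, inv_inv, ← Real.exp_neg, mul_add, mul_one,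
      ← Real.exp_add]
    ring_nf
  simp only []
  rw [key, abs_of_pos (mul_pos hx0 hx1), Complex.real_smul]
  have e1 : ((Real.sigmoid y : ℝ) : ℂ) = Complex.exp (Real.log (Real.sigmoid y) : ℝ) := by
    rw [← Complex.ofReal_exp, Real.exp_log hx0]
  have e2 : ((1 - Real.sigmoid y : ℝ) : ℂ) = Complex.exp (Real.log (1 - Real.sigmoid y) : ℝ) := by
    rw [← Complex.ofReal_exp, Real.exp_log hx1]
  have p1 (w : ℂ) : ((Real.sigmoid y : ℝ) : ℂ) ^ w
      = Complex.exp ((Real.log (Real.sigmoid y) : ℝ) * w) := by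
    rw [Complex.cpow_def_of_ne_zero (by exact_mod_cast hx0.ne'), Complex.ofReal_log hx0.le]
  have p2 (w : ℂ) : ((1 - Real.sigmoid y : ℝ) : ℂ) ^ w
      = Complex.exp ((Real.log (1 - Real.sigmoid y) : ℝ) * w) := by
    rw [Complex.cpow_def_of_ne_zero (by exact_mod_cast hx1.ne'), Complex.ofReal_log hx1.le]
  have e3 : (1 : ℂ) - (Real.sigmoid y : ℝ) = ((1 - Real.sigmoid y : ℝ) : ℂ) := by push_cast; rfl
  rw [e3, p1, p2, Complex.ofReal_mul, e1, e2, hl1, hl2, Complex.ofReal_exp, ← Complex.exp_add,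
    ← Complex.exp_add, ← Complex.exp_add, ← Complex.exp_add]
  congr 1
  push_cast
  ring

open scoped FourierTransform in
/-- The Fourier transform of `x ↦ sech (s x)`. -/
lemma fourier_inv_cosh {s : ℝ} (hs : 0 < s) (ξ : ℝ) :
    𝓕 (fun x : ℝ => (((Real.cosh (s * x))⁻¹ : ℝ) : ℂ)) ξ =
      ((Real.pi / s * (Real.cosh (ξ * (Real.pi ^ 2 / s)))⁻¹ : ℝ) : ℂ) := by
  set η : ℝ := Real.pi * ξ / s with hη
  have h1 := betaIntegral_eq_integral_inv_cosh η
  -- The two arguments sum to 1, so the beta integral is `Γ(z)Γ(1-z)`, and the reflection formula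
  -- evaluates it as `π/cosh(πη)`.
  have h2 := Complex.Gamma_mul_Gamma_eq_betaIntegral
    (s := 1 / 2 - η * Complex.I) (t := 1 / 2 + η * Complex.I) (by simp) (by simp)
  have h3 := Complex.Gamma_mul_Gamma_one_sub (1 / 2 - η * Complex.I)
  have h4 : (1 : ℂ) - (1 / 2 - η * Complex.I) = 1 / 2 + η * Complex.I := by ring
  have h5 : (1 / 2 - η * Complex.I) + (1 / 2 + η * Complex.I) = (1 : ℂ) := by ring
  rw [h4] at h3
  rw [h5, Complex.Gamma_one, one_mul] at h2
  have h6 : Complex.sin (Real.pi * (1 / 2 - η * Complex.I)) = (Real.cosh (Real.pi * η) : ℝ) := by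
    rw [show (Real.pi : ℂ) * (1 / 2 - η * Complex.I)
      = Real.pi / 2 - (Real.pi * η : ℝ) * Complex.I by push_cast; ring,
      Complex.sin_pi_div_two_sub, Complex.cos_mul_I, Complex.ofReal_cosh]
  rw [← h2, h3, h6] at h1
  rw [Real.fourier_real_eq_integral_exp_smul]
  have h7 := Measure.integral_comp_mul_left (fun y : ℝ => Complex.exp (-(η * y) * Complex.I) *
    (((2 * Real.cosh (y / 2))⁻¹ : ℝ) : ℂ)) (2 * s)
  rw [← h1] at h7
  have h8 : (∫ v : ℝ, Complex.exp (((-2 * Real.pi * v * ξ : ℝ) : ℂ) * Complex.I) •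
      (((Real.cosh (s * v))⁻¹ : ℝ) : ℂ)) = 2 * ∫ x : ℝ, Complex.exp (-(η * ((2 * s * x : ℝ) : ℂ)) * Complex.I) *
    (((2 * Real.cosh (2 * s * x / 2))⁻¹ : ℝ) : ℂ) := by
    rw [← integral_const_mul]
    refine integral_congr_ae (Eventually.of_forall fun v => ?_)
    simp only []
    have hs' : (s : ℂ) ≠ 0 := by exact_mod_cast hs.ne'
    rw [smul_eq_mul, show 2 * s * v / 2 = s * v by ring, mul_inv]
    have : -(η * ((2 * s * v : ℝ) : ℂ)) = ((-2 * Real.pi * v * ξ : ℝ) : ℂ) := by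
      rw [hη]; push_cast; field_simp
    rw [this]
    push_cast
    ring
  rw [h8, h7, abs_of_pos (by positivity), Complex.real_smul,
    show ξ * (Real.pi ^ 2 / s) = Real.pi * η by rw [hη]; ring]
  have hc : ((Real.cosh (Real.pi * η) : ℝ) : ℂ) ≠ 0 := by exact_mod_cast (Real.cosh_pos _).ne'
  push_cast at hc ⊢
  field_simp

/-- At `x = 0` this makes `sechSum` self-dual; at `x = 1/2` the characters become `(-1)^n`, so
`halfSechSum` is dual to `altSechSum`. -/
lemma poisson_inv_cosh {s : ℝ} (hs : 0 < s) (x : ℝ) :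
    ∑' n : ℤ, (((Real.cosh (s * (x + n)))⁻¹ : ℝ) : ℂ) =
      ∑' n : ℤ, ((Real.pi / s * (Real.cosh (n * (Real.pi ^ 2 / s)))⁻¹ : ℝ) : ℂ) *
        fourier n (x : UnitAddCircle) := by
  have hc : Continuous fun x : ℝ => (((Real.cosh (s * x))⁻¹ : ℝ) : ℂ) := by
    refine Complex.continuous_ofReal.comp (Continuous.inv₀ ?_ fun x => (Real.cosh_pos _).ne')
    exact Real.continuous_cosh.comp (by fun_prop)
  have h := Real.tsum_eq_tsum_fourier_of_rpow_decay_of_summable hc one_lt_two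
    (inv_cosh_isBigO_cocompact hs.ne') ?_ x
  · simpa only [fourier_inv_cosh hs] using h
  · simp only [fourier_inv_cosh hs]
    rw [Complex.summable_ofReal]
    exact (summable_inv_cosh (by positivity)).mul_left _

lemma sechSum_eq_dual {s : ℝ} (hs : 0 < s) :
    sechSum s = Real.pi / s * sechSum (Real.pi ^ 2 / s) := by
  have h := poisson_inv_cosh hs 0
  simp only [zero_add, QuotientAddGroup.mk_zero, fourier_eval_zero, mul_one] at h
  rw [← Complex.ofReal_tsum, ← Complex.ofReal_tsum, Complex.ofReal_inj, tsum_mul_left] at h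
  simpa only [sechSum, mul_comm s] using h

lemma halfSechSum_eq_dual {s : ℝ} (hs : 0 < s) :
    halfSechSum s = Real.pi / s * altSechSum (Real.pi ^ 2 / s) := by
  have h := poisson_inv_cosh hs (1 / 2)
  have hf (n : ℤ) : fourier n ((1 / 2 : ℝ) : UnitAddCircle) = (((-1 : ℝ) ^ n : ℝ) : ℂ) := by
    rw [fourier_coe_apply, show 2 * (Real.pi : ℂ) * Complex.I * n * ((1 / 2 : ℝ) : ℂ) / ((1 : ℝ) : ℂ)
      = n * (Real.pi * Complex.I) by push_cast; ring, Complex.exp_int_mul, Complex.exp_pi_mul_I]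
    push_cast; rfl
  simp only [hf, ← Complex.ofReal_mul] at h
  rw [← Complex.ofReal_tsum, ← Complex.ofReal_tsum, Complex.ofReal_inj] at h
  rw [halfSechSum, altSechSum, ← tsum_mul_left]
  calc _ = _ := tsum_congr fun n => by rw [mul_comm, add_comm]
    _ = _ := h
    _ = _ := tsum_congr fun n => by ring

/-! ### Telescoping and products of series over the integers -/

lemma hasSum_of_eq {ι : Type*} {f g : ι → ℝ} {a b : ℝ} (h : HasSum f a)
    (hfg : ∀ i, g i = f i) (hab : b = a) : HasSum g b := by
  rw [hab, funext hfg]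
  exact h

lemma hasSum_nat_sub_of_tendsto {u : ℕ → ℝ} {L : ℝ} (hs : Summable fun n => u (n + 1) - u n)
    (h : Tendsto u atTop (𝓝 L)) : HasSum (fun n => u (n + 1) - u n) (L - u 0) := by
  have h1 := hs.hasSum.tendsto_sum_nat
  simp only [Finset.sum_range_sub] at h1
  rw [tendsto_nhds_unique (h.sub_const (u 0)) h1]
  exact hs.hasSum

/-- A telescoping sum over the integers. -/
lemma hasSum_int_sub_of_tendsto {g : ℤ → ℝ} {L L' : ℝ}
    (hs : Summable fun n : ℤ => g (n + 1) - g n)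
    (h1 : Tendsto (fun n : ℕ => g n) atTop (𝓝 L))
    (h2 : Tendsto (fun n : ℕ => g (-n)) atTop (𝓝 L')) :
    HasSum (fun n : ℤ => g (n + 1) - g n) (L - L') := by
  have s1 : Summable fun n : ℕ => g ((n : ℤ) + 1) - g n :=
    hs.comp_injective (i := fun n : ℕ => (n : ℤ)) Nat.cast_injective
  have hz (n : ℕ) : -((n : ℤ) + 1) + 1 = -(n : ℤ) := by ring
  have s2 : Summable fun n : ℕ => g (-(n : ℤ)) - g (-((n : ℤ) + 1)) := by
    refine (hs.comp_injective (i := fun n : ℕ => -((n : ℤ) + 1))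
      (fun a b h => by simpa using h)).congr fun n => ?_
    simp only [Function.comp, hz]
  have e1 := hasSum_nat_sub_of_tendsto (u := fun n : ℕ => g n) (by simpa using s1) h1
  have e2 := (hasSum_nat_sub_of_tendsto (u := fun n : ℕ => g (-n)) (by simpa using s2.neg) h2).neg
  have e3 := HasSum.of_nat_of_neg_add_one (f := fun n : ℤ => g (n + 1) - g n)
    (hasSum_of_eq e1 (fun n => by push_cast; rfl) rfl)
    (hasSum_of_eq e2 (fun n => by rw [hz]; push_cast; ring) rfl)
  refine hasSum_of_eq e3 (fun _ => rfl) ?_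
  simp only [Nat.cast_zero, neg_zero]
  ring

lemma hasSum_int_add_sub {g : ℤ → ℝ} {W : ℝ}
    (h : HasSum (fun n : ℤ => g (n + 1) - g n) W) (d : ℤ) :
    HasSum (fun n : ℤ => g (n + d) - g n) (d * W) := by
  have hsh (d : ℤ) : HasSum (fun n : ℤ => g (n + d + 1) - g (n + d)) W :=
    (Equiv.addRight d).hasSum_iff.mpr h
  induction d using Int.induction_on with
  | zero => simp
  | succ i ih =>
    refine hasSum_of_eq (ih.add (hsh i)) (fun n => ?_) ?_
    · rw [← add_assoc]; ring
    · push_cast; ring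
  | pred i ih =>
    refine hasSum_of_eq (ih.sub (hsh (-i - 1))) (fun n => ?_) ?_
    · rw [show n + (-(i : ℤ) - 1) + 1 = n + -(i : ℤ) by ring]; ring
    · push_cast; ring

lemma hasSum_int_alternating_add_sub {g : ℤ → ℝ}
    (h : HasSum (fun n : ℤ => (-1 : ℝ) ^ n * (g (n + 1) - g n)) 0) (d : ℤ) :
    HasSum (fun n : ℤ => (-1 : ℝ) ^ n * (g (n + d) - g n)) 0 := by
  -- Shifting the index multiplies the sum by a sign, which is harmless because the sum is 0.
  have hsh (d : ℤ) : HasSum (fun n : ℤ => (-1 : ℝ) ^ n * (g (n + d + 1) - g (n + d))) 0 := by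
    refine hasSum_of_eq (((Equiv.addRight d).hasSum_iff.mpr h).mul_left ((-1 : ℝ) ^ (-d)))
      (fun n => ?_) (mul_zero _).symm
    simp only [Function.comp, Equiv.coe_addRight]
    rw [← mul_assoc, ← zpow_add₀ (by norm_num)]
    congr 2
    ring
  induction d using Int.induction_on with
  | zero => simp
  | succ i ih =>
    refine hasSum_of_eq (ih.add (hsh i)) (fun n => ?_) (by simp)
    rw [← add_assoc]; ring
  | pred i ih =>
    refine hasSum_of_eq (ih.sub (hsh (-i - 1))) (fun n => ?_) (by simp)
    rw [show n + (-(i : ℤ) - 1) + 1 = n + -(i : ℤ) by ring]; ring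

/-- Product of two integer-indexed series, grouped by the difference of the indices. -/
lemma hasSum_int_mul_shift {f g : ℤ → ℝ} (hf : Summable fun n => ‖f n‖)
    (hg : Summable fun n => ‖g n‖) :
    HasSum (fun d : ℤ => ∑' n : ℤ, f (n + d) * g n) ((∑' n, f n) * ∑' n, g n) := by
  have hs := summable_mul_of_summable_norm hf hg
  let e : ℤ × ℤ ≃ ℤ × ℤ :=
    { toFun := fun p => (p.2 + p.1, p.2)
      invFun := fun p => (p.1 - p.2, p.2)
      left_inv := fun p => by simp
      right_inv := fun p => by simp }
  have h1 := hs.hasSum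
  rw [← tsum_mul_tsum_of_summable_norm hf hg, ← e.hasSum_iff] at h1
  exact h1.prod_fiberwise fun d => (h1.summable.prod_factor d).hasSum

/-- The addition formula for `sinh ((x + y) - x)`. It makes every off-diagonal correlation of sech
telescope. -/
lemma inv_cosh_mul_inv_cosh_eq {x y : ℝ} (hy : y ≠ 0) :
    (Real.cosh (x + y))⁻¹ * (Real.cosh x)⁻¹ =
      (Real.sinh y)⁻¹ * (Real.tanh (x + y) - Real.tanh x) := by
  have h1 := (Real.cosh_pos x).ne'
  have h2 := (Real.cosh_pos (x + y)).ne'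
  have h3 : Real.sinh y ≠ 0 := by simpa using hy
  have h4 : Real.sinh y = Real.sinh (x + y) * Real.cosh x - Real.cosh (x + y) * Real.sinh x := by
    rw [← Real.sinh_sub]; ring_nf
  rw [Real.tanh_eq_sinh_div_cosh, Real.tanh_eq_sinh_div_cosh]
  field_simp
  linarith

lemma tendsto_tanh_atTop_one : Tendsto Real.tanh atTop (𝓝 1) := by
  have h : ∀ x : ℝ, Real.tanh x = (1 - Real.exp (-(2 * x))) / (1 + Real.exp (-(2 * x))) := by
    intro x
    have h2 : Real.exp (-(2 * x)) = Real.exp (-x) * Real.exp (-x) := by rw [← Real.exp_add]; ring_nf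
    have h1 : Real.exp x * Real.exp (-x) = 1 := by rw [← Real.exp_add]; simp
    rw [Real.tanh_eq_sinh_div_cosh, Real.sinh_eq, Real.cosh_eq, h2,
      div_eq_div_iff (by positivity) (by positivity)]
    linear_combination Real.exp (-x) * h1
  have e : Tendsto (fun x : ℝ => Real.exp (-(2 * x))) atTop (𝓝 0) :=
    Real.tendsto_exp_neg_atTop_nhds_zero.comp (tendsto_id.const_mul_atTop two_pos)
  have := (e.const_sub 1).div (e.const_add 1) (by norm_num)
  simp only [sub_zero, add_zero, div_one] at this
  exact this.congr fun x => (h x).symm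

/-! ### Products of sech series as sums of correlations -/

section Correlations

variable {t : ℝ}

lemma summable_norm_inv_cosh (ht : 0 < t) :
    Summable fun m : ℤ => ‖(Real.cosh (m * t))⁻¹‖ := (summable_inv_cosh ht.ne').norm

lemma summable_inv_cosh_mul_shift (ht : 0 < t) (d : ℤ) :
    Summable fun n : ℤ => (Real.cosh ((n + d : ℤ) * t))⁻¹ * (Real.cosh (n * t))⁻¹ := by
  refine Summable.of_nonneg_of_le (fun n => by positivity) (fun n => ?_)
    (summable_inv_cosh ht.ne')
  exact mul_le_of_le_one_left (by positivity) (inv_le_one_of_one_le₀ (Real.one_le_cosh _))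

lemma inv_cosh_mul_shift_eq (ht : 0 < t) {d : ℤ} (hd : d ≠ 0) (n : ℤ) :
    (Real.cosh ((n + d : ℤ) * t))⁻¹ * (Real.cosh (n * t))⁻¹ =
      (Real.sinh (d * t))⁻¹ * (Real.tanh ((n + d : ℤ) * t) - Real.tanh (n * t)) := by
  have hd' : (d : ℝ) * t ≠ 0 := mul_ne_zero (by exact_mod_cast hd) ht.ne'
  rw [Int.cast_add, add_mul]
  exact inv_cosh_mul_inv_cosh_eq hd'

lemma summable_tanh_succ_sub (ht : 0 < t) :
    Summable fun n : ℤ => Real.tanh ((n + 1 : ℤ) * t) - Real.tanh (n * t) := by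
  have h3 : Real.sinh ((1 : ℤ) * t) ≠ 0 := by simpa using ht.ne'
  refine ((summable_inv_cosh_mul_shift ht 1).mul_left (Real.sinh ((1 : ℤ) * t))).congr fun n => ?_
  rw [inv_cosh_mul_shift_eq ht one_ne_zero, ← mul_assoc, mul_inv_cancel₀ h3, one_mul]

/-- A unit shift telescopes to the jump of `tanh` from `-1` to `1`; a shift by `d` is `d` such
jumps. -/
lemma hasSum_tanh_shift_sub (ht : 0 < t) (d : ℤ) :
    HasSum (fun n : ℤ => Real.tanh ((n + d : ℤ) * t) - Real.tanh (n * t)) (d * 2) := by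
  refine hasSum_int_add_sub (g := fun n : ℤ => Real.tanh (n * t)) ?_ d
  have hs := summable_tanh_succ_sub ht
  have h1 : Tendsto (fun n : ℕ => Real.tanh (((n : ℤ) : ℝ) * t)) atTop (𝓝 1) := by
    refine tendsto_tanh_atTop_one.comp ?_
    simpa using tendsto_natCast_atTop_atTop.atTop_mul_const ht
  have h2 : Tendsto (fun n : ℕ => Real.tanh (((-n : ℤ) : ℝ) * t)) atTop (𝓝 (-1)) := by
    refine h1.neg.congr fun n => ?_
    rw [← Real.tanh_neg]; push_cast; ring_nf
  exact hasSum_of_eq (hasSum_int_sub_of_tendsto (g := fun n : ℤ => Real.tanh (n * t)) hs h1 h2)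
    (fun _ => rfl) (by norm_num)

lemma hasSum_alternating_tanh_shift_sub (ht : 0 < t) (d : ℤ) :
    HasSum (fun n : ℤ => (-1 : ℝ) ^ n * (Real.tanh ((n + d : ℤ) * t) - Real.tanh (n * t))) 0 := by
  refine hasSum_int_alternating_add_sub (g := fun n : ℤ => Real.tanh (n * t)) ?_ d
  have hs : Summable fun n : ℤ =>
      (-1 : ℝ) ^ n * (Real.tanh ((n + 1 : ℤ) * t) - Real.tanh (n * t)) := by
    refine Summable.of_norm ((summable_tanh_succ_sub ht).norm.congr fun n => ?_)
    rw [norm_mul, norm_zpow, norm_neg, norm_one, one_zpow, one_mul]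
  have h0 := hs.hasSum
  set W := ∑' n : ℤ, (-1 : ℝ) ^ n * (Real.tanh ((n + 1 : ℤ) * t) - Real.tanh (n * t))
  -- The reflection `n ↦ -1 - n` preserves the `tanh` difference and reverses the sign `(-1)^n`, so
  -- the sum is its own negative.
  let e : ℤ ≃ ℤ := Equiv.subLeft (-1)
  have h1 := (e.hasSum_iff.mpr h0).neg
  have h2 : HasSum (fun n : ℤ => (-1 : ℝ) ^ n *
      (Real.tanh ((n + 1 : ℤ) * t) - Real.tanh (n * t))) (-W) := by
    refine hasSum_of_eq h1 (fun n => ?_) rfl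
    simp only [Function.comp, e, Equiv.subLeft_apply]
    rw [show ((-1 - n + 1 : ℤ) : ℝ) * t = -(n * t) by push_cast; ring,
      show ((-1 - n : ℤ) : ℝ) * t = -((n + 1 : ℤ) * t) by push_cast; ring, Real.tanh_neg,
      Real.tanh_neg, zpow_sub₀ (by norm_num)]
    rcases Int.even_or_odd n with hn | hn
    · rw [hn.neg_one_zpow]; norm_num; ring
    · rw [hn.neg_one_zpow]; norm_num; ring
  have h3 := h0.unique h2
  rwa [show W = 0 by linarith] at h0

/-- Grouped by index difference `d`, every `d ≠ 0` contributes an alternating telescoping sum, which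
vanishes; only the diagonal survives. -/
lemma sechSum_mul_altSechSum (ht : 0 < t) :
    sechSum t * altSechSum t = ∑' n : ℤ, (-1 : ℝ) ^ n * (Real.cosh (n * t))⁻¹ ^ 2 := by
  have h := hasSum_int_mul_shift (summable_norm_inv_cosh ht) (summable_alt_inv_cosh ht.ne').norm
  rw [← sechSum, ← altSechSum] at h
  rw [← h.tsum_eq, tsum_eq_single 0]
  · refine tsum_congr fun n => ?_
    rw [add_zero]; ring
  · intro d hd
    have := (hasSum_alternating_tanh_shift_sub ht d).mul_left (Real.sinh (d * t))⁻¹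
    rw [mul_zero] at this
    rw [← this.tsum_eq]
    refine tsum_congr fun n => ?_
    have := inv_cosh_mul_shift_eq ht hd n
    linear_combination (-1 : ℝ) ^ n * this

lemma altSechSum_sq (ht : 0 < t) :
    HasSum (fun d : ℤ => (-1 : ℝ) ^ d * (2 * d * (Real.sinh (d * t))⁻¹))
      (altSechSum t ^ 2 - ∑' n : ℤ, (Real.cosh (n * t))⁻¹ ^ 2) := by
  have hn := (summable_alt_inv_cosh ht.ne').norm
  have h := hasSum_int_mul_shift hn hn
  rw [← altSechSum, ← sq] at h
  -- The diagonal `d = 0` is the sum of squares and is removed separately; the csch term is 0 there.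
  refine hasSum_of_eq (h.sub (hasSum_ite_eq (0 : ℤ) (∑' n : ℤ, (Real.cosh (n * t))⁻¹ ^ 2)))
    (fun d => ?_) rfl
  have hpull : ∑' n : ℤ, (-1 : ℝ) ^ (n + d) * (Real.cosh ((n + d : ℤ) * t))⁻¹ *
      ((-1 : ℝ) ^ n * (Real.cosh (n * t))⁻¹) =
      (-1 : ℝ) ^ d * ∑' n : ℤ, (Real.cosh ((n + d : ℤ) * t))⁻¹ * (Real.cosh (n * t))⁻¹ := by
    rw [← tsum_mul_left]
    refine tsum_congr fun n => ?_
    have : (-1 : ℝ) ^ n * (-1 : ℝ) ^ n = 1 := by rw [← mul_zpow]; simp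
    rw [zpow_add₀ (by norm_num)]
    linear_combination (-1 : ℝ) ^ d * (Real.cosh ((n + d : ℤ) * t))⁻¹ *
      (Real.cosh (n * t))⁻¹ * this
  rw [hpull]
  by_cases hd : d = 0
  · subst hd
    simp [sq]
  · have h3 := ((hasSum_tanh_shift_sub ht d).mul_left (Real.sinh (d * t))⁻¹).tsum_eq
    simp only [← inv_cosh_mul_shift_eq ht hd] at h3
    rw [h3, if_neg hd]
    ring

end Correlations

/-! ### Exponential series, double sums and the Lambert series -/

lemma hasSum_int_even_odd {f : ℤ → ℝ} {a b : ℝ} (he : HasSum (fun k : ℤ => f (2 * k)) a)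
    (ho : HasSum (fun k : ℤ => f (2 * k + 1)) b) : HasSum f (a + b) := by
  have hi := mul_right_injective₀ (two_ne_zero' ℤ)
  replace ho := ((add_left_injective 1).comp hi).hasSum_range_iff.2 ho
  refine (hi.hasSum_range_iff.2 he).add_isCompl ?_ ho
  simpa [Function.comp_def] using! Int.isCompl_even_odd

lemma hasSum_alternating_exp {x : ℝ} (hx : 0 < x) :
    HasSum (fun n : ℕ => (-1 : ℝ) ^ n * Real.exp (-(x * (2 * n + 1)))) ((Real.cosh x)⁻¹ / 2) := by
  have h : |(-Real.exp (-(2 * x)))| < 1 := by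
    rw [abs_neg, abs_of_pos (Real.exp_pos _), Real.exp_lt_one_iff]; linarith
  refine hasSum_of_eq ((hasSum_geometric_of_abs_lt_one h).mul_left (Real.exp (-x))) (fun n => ?_) ?_
  · rw [neg_pow (Real.exp _), ← Real.exp_nat_mul, mul_left_comm (Real.exp _),
      ← Real.exp_add]
    ring_nf
  · have h2 : Real.exp (-(2 * x)) = Real.exp (-x) * Real.exp (-x) := by rw [← Real.exp_add]; ring_nf
    have h1 : Real.exp x * Real.exp (-x) = 1 := by rw [← Real.exp_add]; simp
    have := Real.exp_pos (-x)
    have := Real.exp_pos x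
    rw [Real.cosh_eq, h2, sub_neg_eq_add]
    field_simp
    linear_combination -h1

lemma hasSum_exp_succ_mul {y : ℝ} (hy : 0 < y) :
    HasSum (fun m : ℕ => Real.exp (-((m + 1) * y))) (Real.exp y - 1)⁻¹ := by
  have h : |Real.exp (-y)| < 1 := by
    rw [abs_of_pos (Real.exp_pos _), Real.exp_lt_one_iff]; linarith
  refine hasSum_of_eq ((hasSum_geometric_of_abs_lt_one h).mul_left (Real.exp (-y))) (fun n => ?_) ?_
  · rw [← Real.exp_nat_mul, ← Real.exp_add]
    ring_nf
  · have h1 : Real.exp y * Real.exp (-y) = 1 := by rw [← Real.exp_add]; simp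
    have h2 : 1 < Real.exp y := Real.one_lt_exp_iff.2 hy
    have h3 : Real.exp (-y) < 1 := (le_abs_self _).trans_lt h
    have h4 : Real.exp y - 1 ≠ 0 := by linarith
    have h5 : 1 - Real.exp (-y) ≠ 0 := by linarith
    field_simp
    linear_combination -h1

lemma hasSum_exp_odd_mul {y : ℝ} (hy : 0 < y) :
    HasSum (fun n : ℕ => Real.exp (-((2 * n + 1) * y))) ((Real.sinh y)⁻¹ / 2) := by
  have h : |Real.exp (-(2 * y))| < 1 := by
    rw [abs_of_pos (Real.exp_pos _), Real.exp_lt_one_iff]; linarith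
  refine hasSum_of_eq ((hasSum_geometric_of_abs_lt_one h).mul_left (Real.exp (-y))) (fun n => ?_) ?_
  · rw [← Real.exp_nat_mul, ← Real.exp_add]
    ring_nf
  · have h2 : Real.exp (-(2 * y)) = Real.exp (-y) ^ 2 := by
      rw [← Real.exp_nat_mul]; ring_nf
    have h1 : Real.exp y * Real.exp (-y) = 1 := by rw [← Real.exp_add]; simp
    have h3 : Real.exp (-(2 * y)) < 1 := (le_abs_self _).trans_lt h
    have h5 : 1 - Real.exp (-y) ^ 2 ≠ 0 := by rw [← h2]; linarith
    have h6 : Real.exp y - Real.exp (-y) ≠ 0 := by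
      have : Real.exp (-y) < Real.exp y := Real.exp_lt_exp.2 (by linarith)
      linarith
    rw [Real.sinh_eq, h2]
    field_simp
    linear_combination -h1

lemma hasSum_alternating_mul_exp {x : ℝ} (hx : 0 < x) :
    HasSum (fun j : ℕ => 4 * (j * ((-1 : ℝ) ^ j * Real.exp (-(2 * j * x)))))
      (-(Real.cosh x)⁻¹ ^ 2) := by
  have h : ‖-Real.exp (-(2 * x))‖ < 1 := by
    rw [norm_neg, Real.norm_of_nonneg (Real.exp_pos _).le, Real.exp_lt_one_iff]; linarith
  refine hasSum_of_eq ((hasSum_coe_mul_geometric_of_norm_lt_one h).mul_left 4) (fun n => ?_) ?_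
  · rw [neg_pow (Real.exp _), ← Real.exp_nat_mul]
    ring_nf
  · have h2 : Real.exp (-(2 * x)) = Real.exp (-x) * Real.exp (-x) := by rw [← Real.exp_add]; ring_nf
    have h1 : Real.exp x * Real.exp (-x) = 1 := by rw [← Real.exp_add]; simp
    have := Real.exp_pos (-x)
    have := Real.exp_pos x
    have h3 : (Real.cosh x)⁻¹ = 2 * Real.exp (-x) / (1 + Real.exp (-x) * Real.exp (-x)) := by
      rw [Real.cosh_eq]
      field_simp
      linear_combination -h1
    rw [h3, h2, sub_neg_eq_add]
    field_simp
    norm_num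

lemma hasSum_swap {F : ℕ × ℕ → ℝ} (hF : Summable F) {f g : ℕ → ℝ}
    (hf : ∀ m, HasSum (fun n => F (m, n)) (f m)) (hg : ∀ n, HasSum (fun m => F (m, n)) (g n)) :
    ∃ A, HasSum f A ∧ HasSum g A :=
  ⟨∑' p, F p, hF.hasSum.prod_fiberwise hf,
    ((Equiv.prodComm ℕ ℕ).hasSum_iff.mpr hF.hasSum).prod_fiberwise hg⟩

lemma summable_exp_neg_nat_mul {y : ℝ} (hy : 0 < y) :
    Summable fun n : ℕ => Real.exp (-(n * y)) := by
  refine (summable_geometric_of_lt_one (Real.exp_pos (-y)).le (by simpa)).congr fun n => ?_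
  rw [← Real.exp_nat_mul]; ring_nf

/-- The Lambert series of `sechSum`. -/
lemma hasSum_lambert_sechSum {s : ℝ} (hs : 0 < s) :
    HasSum (fun n : ℕ => (-1 : ℝ) ^ n * (Real.exp (s * (2 * n + 1)) - 1)⁻¹)
      ((sechSum s - 1) / 4) := by
  -- The double series is geometric in each index: summing over `n` gives sech terms, summing over
  -- `m` gives Lambert terms.
  have hF : Summable fun p : ℕ × ℕ =>
      (-1 : ℝ) ^ p.2 * Real.exp (-((p.1 + 1) * (s * (2 * p.2 + 1)))) := by
    refine Summable.of_norm_bounded ((summable_exp_neg_nat_mul hs).mul_of_nonneg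
      (summable_exp_neg_nat_mul hs) (fun _ => by positivity) (fun _ => by positivity))
      fun p => ?_
    rw [norm_mul, norm_pow, norm_neg, norm_one, one_pow, one_mul, Real.norm_of_nonneg
      (Real.exp_pos _).le, ← Real.exp_add]
    refine Real.exp_le_exp.2 ?_
    have h1 : (0 : ℝ) ≤ p.1 := by positivity
    have h2 : (0 : ℝ) ≤ p.2 := by positivity
    nlinarith [mul_nonneg (mul_nonneg h1 h2) hs.le, mul_nonneg h2 hs.le]
  obtain ⟨A, hA1, hA2⟩ := hasSum_swap hF
    (f := fun m : ℕ => (Real.cosh ((m + 1) * s))⁻¹ / 2)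
    (g := fun n : ℕ => (-1 : ℝ) ^ n * (Real.exp (s * (2 * n + 1)) - 1)⁻¹)
    (fun m => hasSum_of_eq (hasSum_alternating_exp (x := (m + 1) * s) (by positivity))
      (fun n => by ring_nf) rfl)
    (fun n => (hasSum_exp_succ_mul (by positivity)).mul_left _)
  have h1 : HasSum (fun m : ℕ => (Real.cosh ((m + 1) * s))⁻¹) (2 * A) :=
    hasSum_of_eq (hA1.mul_left 2) (fun m => by ring) rfl
  have h2 : HasSum (fun m : ℕ => (Real.cosh (m * s))⁻¹) (1 + 2 * A) := by
    have := (hasSum_nat_add_iff (f := fun m : ℕ => (Real.cosh (m * s))⁻¹) 1).1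
      (hasSum_of_eq h1 (fun m => by push_cast; rfl) rfl)
    exact hasSum_of_eq this (fun _ => rfl) (by simp; ring)
  -- The term `m = 0` gives 1 and each half-line `2A`, so `sechSum s = 1 + 4A`.
  have h3 := HasSum.of_nat_of_neg_add_one (f := fun m : ℤ => (Real.cosh (m * s))⁻¹)
    (hasSum_of_eq h2 (fun m => by push_cast; rfl) rfl)
    (hasSum_of_eq h1 (fun m => by
      rw [← Real.cosh_neg ((m + 1) * s)]; push_cast; ring_nf) rfl)
  refine hasSum_of_eq hA2 (fun _ => rfl) ?_
  rw [sechSum, h3.tsum_eq]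
  ring

/-! ### Quadratic identities between the three series -/

section Identities

variable {t : ℝ}

lemma summable_nat_mul_exp_neg (ht : 0 < t) :
    Summable fun j : ℕ => (j : ℝ) * Real.exp (-(j * t)) := by
  have h : ‖Real.exp (-t)‖ < 1 := by
    rw [Real.norm_of_nonneg (Real.exp_pos _).le, Real.exp_lt_one_iff]; linarith
  refine (hasSum_coe_mul_geometric_of_norm_lt_one h).summable.congr fun n => ?_
  rw [← Real.exp_nat_mul]
  ring_nf

lemma summable_alternating_mul_exp_odd (ht : 0 < t) :
    Summable fun p : ℕ × ℕ =>
      4 * (p.2 * ((-1 : ℝ) ^ p.2 * Real.exp (-(2 * p.2 * ((2 * p.1 + 1) * t))))) := by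
  refine Summable.mul_left 4 ?_
  refine Summable.of_norm_bounded ((summable_exp_neg_nat_mul ht).mul_of_nonneg
    (summable_nat_mul_exp_neg ht) (fun _ => by positivity) (fun _ => by positivity)) fun p => ?_
  rw [norm_mul, norm_mul, norm_pow, norm_neg, norm_one, one_pow, one_mul, Real.norm_of_nonneg
    (Real.exp_pos _).le, Real.norm_of_nonneg (by positivity), mul_left_comm (Real.exp _),
    ← Real.exp_add]
  rcases Nat.eq_zero_or_pos p.2 with h0 | h0
  · simp [h0]
  · refine mul_le_mul_of_nonneg_left (Real.exp_le_exp.2 ?_) (by positivity)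
    have h1 : (0 : ℝ) ≤ p.1 := by positivity
    have h2 : (1 : ℝ) ≤ p.2 := by exact_mod_cast h0
    nlinarith [mul_nonneg (mul_nonneg h1 (sub_nonneg.2 h2)) ht.le, mul_nonneg h1 ht.le]

lemma hasSum_mul_exp_odd (ht : 0 < t) (j : ℕ) :
    HasSum (fun m : ℕ => 4 * (j * ((-1 : ℝ) ^ j * Real.exp (-(2 * j * ((2 * m + 1) * t))))))
      ((-1 : ℝ) ^ j * (2 * j * (Real.sinh (j * (2 * t)))⁻¹)) := by
  rcases Nat.eq_zero_or_pos j with h0 | h0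
  · simp [h0]
  · have hj : (0 : ℝ) < j := by exact_mod_cast h0
    refine hasSum_of_eq ((hasSum_exp_odd_mul (y := j * (2 * t)) (by positivity)).mul_left
      (4 * (j * (-1 : ℝ) ^ j))) (fun n => ?_) (by ring)
    rw [show 2 * (j : ℝ) * ((2 * n + 1) * t) = (2 * n + 1) * (j * (2 * t)) by ring]
    ring

/-- One double series summed in both orders; it turns the csch sum in the square of `altSechSum`
into sech squares at odd multiples of `t`. -/
lemma exists_hasSum_csch_sech_sq (ht : 0 < t) :
    ∃ A, HasSum (fun n : ℕ => -(Real.cosh ((2 * n + 1) * t))⁻¹ ^ 2) A ∧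
      HasSum (fun j : ℕ => (-1 : ℝ) ^ j * (2 * j * (Real.sinh (j * (2 * t)))⁻¹)) A :=
  hasSum_swap (F := fun p : ℕ × ℕ =>
      4 * (p.2 * ((-1 : ℝ) ^ p.2 * Real.exp (-(2 * p.2 * ((2 * p.1 + 1) * t))))))
    (summable_alternating_mul_exp_odd ht)
    (fun m => hasSum_alternating_mul_exp (x := (2 * m + 1) * t) (by positivity))
    (hasSum_mul_exp_odd ht)

/-- The geometric-mean step. -/
lemma altSechSum_two_mul_sq (ht : 0 < t) :
    altSechSum (2 * t) ^ 2 = sechSum t * altSechSum t := by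
  -- Over the integers both sums double. So `altSechSum_sq` at `2t` reads: even-index sech squares
  -- minus odd-index ones, which is the diagonal sum in `sechSum_mul_altSechSum`.
  obtain ⟨A, hA1, hA2⟩ := exists_hasSum_csch_sech_sq ht
  have h1 := altSechSum_sq (t := 2 * t) (by positivity)
  have h2 : HasSum (fun d : ℤ => (-1 : ℝ) ^ d * (2 * d * (Real.sinh (d * (2 * t)))⁻¹))
      (A + A) := by
    refine hasSum_of_eq (HasSum.of_nat_of_neg
      (f := fun d : ℤ => (-1 : ℝ) ^ d * (2 * d * (Real.sinh (d * (2 * t)))⁻¹))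
      (hasSum_of_eq hA2 (fun n => by push_cast; rfl) rfl)
      (hasSum_of_eq hA2 (fun n => ?_) rfl)) (fun _ => rfl) (by simp)
    rw [zpow_neg, zpow_natCast, ← inv_pow]
    push_cast
    rw [neg_mul (n : ℝ), Real.sinh_neg]
    norm_num
  have h3 : HasSum (fun n : ℤ => (Real.cosh ((2 * n + 1 : ℤ) * t))⁻¹ ^ 2) (-A + -A) := by
    refine HasSum.of_nat_of_neg_add_one
      (f := fun n : ℤ => (Real.cosh ((2 * n + 1 : ℤ) * t))⁻¹ ^ 2)
      (hasSum_of_eq hA1.neg (fun n => by push_cast; ring) rfl)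
      (hasSum_of_eq hA1.neg (fun n => ?_) rfl)
    rw [neg_neg, ← Real.cosh_neg ((2 * n + 1) * t)]
    push_cast
    ring_nf
  have h4 : Summable fun n : ℤ => (Real.cosh (n * (2 * t)))⁻¹ ^ 2 := by
    refine Summable.of_nonneg_of_le (fun n => by positivity) (fun n => ?_)
      (summable_inv_cosh (t := 2 * t) (by positivity))
    rw [sq]
    exact mul_le_of_le_one_left (by positivity) (inv_le_one_of_one_le₀ (Real.one_le_cosh _))
  have h5 : HasSum (fun n : ℤ => (-1 : ℝ) ^ n * (Real.cosh (n * t))⁻¹ ^ 2)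
      ((∑' n : ℤ, (Real.cosh (n * (2 * t)))⁻¹ ^ 2) + (A + A)) := by
    refine hasSum_int_even_odd (hasSum_of_eq h4.hasSum (fun k => ?_) rfl)
      (hasSum_of_eq h3.neg (fun k => ?_) (by ring))
    · rw [(even_two_mul k).neg_one_zpow]; push_cast; ring_nf
    · rw [(odd_two_mul_add_one k).neg_one_zpow]; ring
  rw [sechSum_mul_altSechSum ht, h5.tsum_eq]
  linarith [h2.unique h1]

lemma summable_inv_cosh_even (ht : 0 < t) :
    Summable fun k : ℤ => (Real.cosh ((2 * k : ℤ) * t))⁻¹ :=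
  (summable_inv_cosh ht.ne').comp_injective (i := fun k : ℤ => 2 * k)
    (mul_right_injective₀ two_ne_zero)

lemma summable_inv_cosh_odd (ht : 0 < t) :
    Summable fun k : ℤ => (Real.cosh ((2 * k + 1 : ℤ) * t))⁻¹ :=
  (summable_inv_cosh ht.ne').comp_injective (i := fun k : ℤ => 2 * k + 1)
    (fun a b h => by simpa using h)

lemma hasSum_inv_cosh_even (ht : 0 < t) :
    HasSum (fun k : ℤ => (Real.cosh ((2 * k : ℤ) * t))⁻¹) (sechSum (2 * t)) :=
  hasSum_of_eq (summable_inv_cosh_even ht).hasSum (fun _ => rfl)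
    (tsum_congr fun k => by push_cast; ring_nf)

lemma hasSum_inv_cosh_odd (ht : 0 < t) :
    HasSum (fun k : ℤ => (Real.cosh ((2 * k + 1 : ℤ) * t))⁻¹) (halfSechSum (2 * t)) :=
  hasSum_of_eq (summable_inv_cosh_odd ht).hasSum (fun _ => rfl)
    (tsum_congr fun k => by push_cast; ring_nf)

lemma sechSum_eq_add (ht : 0 < t) : sechSum t = sechSum (2 * t) + halfSechSum (2 * t) :=
  (hasSum_int_even_odd (f := fun n : ℤ => (Real.cosh (n * t))⁻¹)
    (hasSum_inv_cosh_even ht) (hasSum_inv_cosh_odd ht)).tsum_eq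

lemma altSechSum_eq_sub (ht : 0 < t) : altSechSum t = sechSum (2 * t) - halfSechSum (2 * t) := by
  rw [sub_eq_add_neg]
  refine (hasSum_int_even_odd (f := fun n : ℤ => (-1 : ℝ) ^ n * (Real.cosh (n * t))⁻¹)
    (hasSum_of_eq (hasSum_inv_cosh_even ht) (fun k => ?_) rfl)
    (hasSum_of_eq (hasSum_inv_cosh_odd ht).neg (fun k => ?_) rfl)).tsum_eq
  · rw [(even_two_mul k).neg_one_zpow, one_mul]
  · rw [(odd_two_mul_add_one k).neg_one_zpow, neg_one_mul]

lemma sechSum_pos (ht : 0 < t) : 0 < sechSum t :=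
  (summable_inv_cosh ht.ne').tsum_pos (fun n => by positivity) 0 (by simp)

lemma halfSechSum_pos (ht : 0 < t) : 0 < halfSechSum t := by
  have h := hasSum_inv_cosh_odd (t := t / 2) (by positivity)
  rw [mul_div_cancel₀ _ two_ne_zero] at h
  rw [← h.tsum_eq]
  exact h.summable.tsum_pos (fun n => by positivity) 0 (by positivity)

/-- The terms alternate in sign, so positivity is read off the dual series instead. -/
lemma altSechSum_pos (ht : 0 < t) : 0 < altSechSum t := by
  have h := halfSechSum_eq_dual (s := Real.pi ^ 2 / t) (by positivity)
  have h2 := halfSechSum_pos (t := Real.pi ^ 2 / t) (by positivity)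
  rw [h, show Real.pi ^ 2 / (Real.pi ^ 2 / t) = t by field_simp] at h2
  exact (pos_iff_pos_of_mul_pos h2).1 (by positivity)

/-- The Poisson dual of `altSechSum_two_mul_sq`, taken at `π²/(2t)`. -/
lemma halfSechSum_sq (ht : 0 < t) :
    halfSechSum t ^ 2 = 4 * sechSum (2 * t) * halfSechSum (2 * t) := by
  have hu : 0 < Real.pi ^ 2 / (2 * t) := by positivity
  have h := altSechSum_two_mul_sq hu
  rw [halfSechSum_eq_dual ht, sechSum_eq_dual (s := 2 * t) (by positivity),
    halfSechSum_eq_dual (s := 2 * t) (by positivity), mul_pow,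
    show Real.pi ^ 2 / t = 2 * (Real.pi ^ 2 / (2 * t)) by field_simp, h]
  field_simp
  ring

/-- Jacobi's identity: with `A, C` the values of `sechSum`, `halfSechSum` at `2t`, it is `(A+C)² =
(A-C)² + 4AC`. -/
lemma sechSum_sq (ht : 0 < t) : sechSum t ^ 2 = altSechSum t ^ 2 + halfSechSum t ^ 2 := by
  rw [halfSechSum_sq ht, sechSum_eq_add ht, altSechSum_eq_sub ht]
  ring

lemma tendsto_sechSum_atTop : Tendsto sechSum atTop (𝓝 1) := by
  have h := tendsto_tsum_of_dominated_convergence (𝓕 := atTop)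
    (f := fun (t : ℝ) (m : ℤ) => (Real.cosh (m * t))⁻¹) (g := fun m => if m = 0 then 1 else 0)
    (summable_inv_cosh one_ne_zero) (fun m => ?_) ?_
  · rwa [tsum_ite_eq] at h
  · split_ifs with hm
    · simp [hm]
    · have hm' : 0 < |(m : ℝ)| := by positivity
      refine squeeze_zero (fun t => by positivity)
        (g := fun t => 2 * Real.exp (-(|(m : ℝ)| * |t|))) (fun t => ?_) ?_
      · rw [← Real.cosh_abs, abs_mul]
        exact inv_cosh_le_two_mul_exp_neg _
      · rw [show (0 : ℝ) = 2 * 0 by simp]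
        exact (Real.tendsto_exp_neg_atTop_nhds_zero.comp
          (tendsto_abs_atTop_atTop.const_mul_atTop hm')).const_mul 2
  · filter_upwards [eventually_ge_atTop 1] with t ht m
    rw [Real.norm_of_nonneg (by positivity)]
    refine inv_anti₀ (Real.cosh_pos _) ?_
    rw [Real.cosh_le_cosh, abs_mul, abs_mul, abs_one]
    exact mul_le_mul_of_nonneg_left (ht.trans (le_abs_self t)) (abs_nonneg _)

lemma tendsto_altSechSum_atTop : Tendsto altSechSum atTop (𝓝 1) := by
  have h2 : Tendsto (fun t : ℝ => 2 * t) atTop atTop := tendsto_id.const_mul_atTop two_pos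
  have h := ((tendsto_sechSum_atTop.comp h2).const_mul 2).sub tendsto_sechSum_atTop
  rw [show (2 : ℝ) * 1 - 1 = 1 by norm_num] at h
  refine h.congr' ?_
  filter_upwards [eventually_gt_atTop 0] with t ht
  simp only [Function.comp]
  rw [altSechSum_eq_sub ht, sechSum_eq_add ht]
  ring

end Identities

/-! ### Gauss's transformation and the value of the elliptic integral -/

/-- The symmetric complete elliptic integral of the first kind. -/
noncomputable def symmEllipticK (a b : ℝ) : ℝ :=
  ∫ φ in (0 : ℝ)..(Real.pi / 2), (Real.sqrt (a ^ 2 * Real.cos φ ^ 2 + b ^ 2 * Real.sin φ ^ 2))⁻¹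

lemma image_arctan_div {b : ℝ} (hb : 0 < b) :
    (fun x : ℝ => Real.arctan (x / b)) '' Ioi 0 = Ioo 0 (Real.pi / 2) := by
  ext y
  constructor
  · rintro ⟨x, hx, rfl⟩
    exact ⟨Real.arctan_pos.2 (div_pos hx hb), Real.arctan_lt_pi_div_two _⟩
  · rintro ⟨h1, h2⟩
    refine ⟨b * Real.tan y, mul_pos hb (Real.tan_pos_of_pos_of_lt_pi_div_two h1 h2), ?_⟩
    simp only []
    rw [mul_div_cancel_left₀ _ hb.ne', Real.arctan_tan (by linarith [Real.pi_pos]) h2]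

/-- The substitution `x = b tan φ` gives the algebraic form used in Gauss's transformation. -/
lemma symmEllipticK_eq_integral_Ioi {a b : ℝ} (ha : 0 < a) (hb : 0 < b) :
    symmEllipticK a b = ∫ x in Ioi (0 : ℝ), (Real.sqrt ((x ^ 2 + a ^ 2) * (x ^ 2 + b ^ 2)))⁻¹ := by
  rw [symmEllipticK, intervalIntegral.integral_of_le (by positivity),
    integral_Ioc_eq_integral_Ioo, ← image_arctan_div hb,
    integral_image_eq_integral_abs_deriv_smul (f := fun x => Real.arctan (x / b))
      (f' := fun x => 1 / (1 + (x / b) ^ 2) * (1 / b))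
      measurableSet_Ioi
      (fun x _ => (((hasDerivAt_id x).div_const b).arctan).hasDerivWithinAt)
      (fun x _ y _ h => by simpa [hb.ne'] using Real.arctan_injective h)]
  refine setIntegral_congr_fun measurableSet_Ioi fun x hx => ?_
  have h1 : a ^ 2 * Real.cos (Real.arctan (x / b)) ^ 2 + b ^ 2 * Real.sin (Real.arctan (x / b)) ^ 2
      = b ^ 2 * (x ^ 2 + a ^ 2) * (x ^ 2 + b ^ 2) / (x ^ 2 + b ^ 2) ^ 2 := by
    rw [Real.sin_sq, Real.cos_sq_arctan]
    field_simp
    ring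
  have h2 : 1 / (1 + (x / b) ^ 2) * (1 / b) = b / (x ^ 2 + b ^ 2) := by
    field_simp
    ring
  rw [h1, h2, Real.sqrt_div (by positivity), Real.sqrt_sq (by positivity), mul_assoc,
    Real.sqrt_mul (by positivity), Real.sqrt_sq hb.le, abs_of_pos (by positivity), smul_eq_mul]
  field_simp

lemma image_sub_div {c : ℝ} (hc : 0 < c) :
    (fun x : ℝ => (x - c / x) / 2) '' Ioi 0 = univ := by
  refine eq_univ_of_forall fun y => ?_
  have h0 : 0 < y ^ 2 + c := by positivity
  have h1 : |y| < Real.sqrt (y ^ 2 + c) := by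
    rw [← Real.sqrt_sq_eq_abs]
    exact Real.sqrt_lt_sqrt (sq_nonneg y) (by linarith)
  have h2 : 0 < y + Real.sqrt (y ^ 2 + c) := by linarith [neg_abs_le y]
  -- The positive root of `x² - 2yx - c = 0`.
  refine ⟨y + Real.sqrt (y ^ 2 + c), h2, ?_⟩
  have h3 := Real.sq_sqrt h0.le
  simp only []
  field_simp
  nlinarith

/-- Gauss's transformation. -/
lemma symmEllipticK_agm_step {a b : ℝ} (ha : 0 < a) (hb : 0 < b) :
    symmEllipticK ((a + b) / 2) (Real.sqrt (a * b)) = symmEllipticK a b := by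
  have hab : 0 < a * b := mul_pos ha hb
  rw [symmEllipticK_eq_integral_Ioi (by positivity) (by positivity),
    symmEllipticK_eq_integral_Ioi ha hb, Real.sq_sqrt hab.le]
  have h1 := integral_comp_abs
    (f := fun x : ℝ => (Real.sqrt ((x ^ 2 + ((a + b) / 2) ^ 2) * (x ^ 2 + a * b)))⁻¹)
  simp only [sq_abs] at h1
  -- The substitution `x ↦ (x - ab/x)/2` carries the half-line onto the whole line. The factor 2
  -- from evenness on the line matches the factor 2 produced in `h3`.
  have hd : ∀ x ∈ Ioi (0 : ℝ), HasDerivWithinAt (fun x : ℝ => (x - a * b / x) / 2)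
      ((1 + a * b / x ^ 2) / 2) (Ioi 0) x := fun x hx => by
    have hx' : x ≠ 0 := ne_of_gt hx
    have := (((hasDerivAt_id x).sub ((hasDerivAt_inv hx').const_mul (a * b))).div_const 2)
    refine HasDerivAt.hasDerivWithinAt ?_
    convert! this using 1
    field_simp
    ring
  have hinj : InjOn (fun x : ℝ => (x - a * b / x) / 2) (Ioi 0) := by
    intro x hx y hy h
    have hx' : 0 < x := hx
    have hy' : 0 < y := hy
    simp only [] at h
    field_simp at h
    have : (x - y) * (x * y + a * b) = 0 := by linear_combination h
    rcases mul_eq_zero.1 this with h | h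
    · linarith
    · nlinarith [mul_pos hx' hy']
  have h2 := integral_image_eq_integral_abs_deriv_smul measurableSet_Ioi hd hinj
    (fun x : ℝ => (Real.sqrt ((x ^ 2 + ((a + b) / 2) ^ 2) * (x ^ 2 + a * b)))⁻¹)
  rw [image_sub_div hab, Measure.restrict_univ, h1] at h2
  have h3 : (∫ x in Ioi (0 : ℝ), |(1 + a * b / x ^ 2) / 2| •
      (Real.sqrt ((((x - a * b / x) / 2) ^ 2 + ((a + b) / 2) ^ 2) *
        (((x - a * b / x) / 2) ^ 2 + a * b)))⁻¹) =
      2 * ∫ x in Ioi (0 : ℝ), (Real.sqrt ((x ^ 2 + a ^ 2) * (x ^ 2 + b ^ 2)))⁻¹ := by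
    rw [← integral_const_mul]
    refine setIntegral_congr_fun measurableSet_Ioi fun x hx => ?_
    have hx' : 0 < x := hx
    have e : (((x - a * b / x) / 2) ^ 2 + ((a + b) / 2) ^ 2) * (((x - a * b / x) / 2) ^ 2 + a * b)
        = ((x ^ 2 + a * b) / (4 * x ^ 2)) ^ 2 * ((x ^ 2 + a ^ 2) * (x ^ 2 + b ^ 2)) := by
      field_simp
      ring
    simp only [e]
    rw [Real.sqrt_mul (by positivity), Real.sqrt_sq (by positivity),
      abs_of_pos (by positivity), smul_eq_mul]
    have : 0 < Real.sqrt ((x ^ 2 + a ^ 2) * (x ^ 2 + b ^ 2)) := by positivity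
    field_simp
    norm_num
  rw [h3] at h2
  linarith

lemma sq_mul_cos_add_sq_mul_sin_mem {a b m M : ℝ} (hm : 0 < m) (ha : a ∈ Icc m M)
    (hb : b ∈ Icc m M) (φ : ℝ) :
    a ^ 2 * Real.cos φ ^ 2 + b ^ 2 * Real.sin φ ^ 2 ∈ Icc (m ^ 2) (M ^ 2) := by
  have h := Real.sin_sq_add_cos_sq φ
  have h1 : m ^ 2 ≤ a ^ 2 := pow_le_pow_left₀ hm.le ha.1 2
  have h2 : m ^ 2 ≤ b ^ 2 := pow_le_pow_left₀ hm.le hb.1 2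
  have h3 : a ^ 2 ≤ M ^ 2 := pow_le_pow_left₀ (hm.le.trans ha.1) ha.2 2
  have h4 : b ^ 2 ≤ M ^ 2 := pow_le_pow_left₀ (hm.le.trans hb.1) hb.2 2
  constructor <;> nlinarith [sq_nonneg (Real.sin φ), sq_nonneg (Real.cos φ)]

lemma symmEllipticK_mem_Icc {a b m M : ℝ} (hm : 0 < m) (ha : a ∈ Icc m M) (hb : b ∈ Icc m M) :
    symmEllipticK a b ∈ Icc (Real.pi / 2 * M⁻¹) (Real.pi / 2 * m⁻¹) := by
  have hM : 0 < M := hm.trans_le (ha.1.trans ha.2)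
  have hmem := sq_mul_cos_add_sq_mul_sin_mem hm ha hb
  have hpos : ∀ φ : ℝ, 0 < a ^ 2 * Real.cos φ ^ 2 + b ^ 2 * Real.sin φ ^ 2 := fun φ =>
    (by positivity : 0 < m ^ 2).trans_le (hmem φ).1
  have hc : Continuous fun φ : ℝ =>
      (Real.sqrt (a ^ 2 * Real.cos φ ^ 2 + b ^ 2 * Real.sin φ ^ 2))⁻¹ :=
    Continuous.inv₀ (by fun_prop) fun φ => (Real.sqrt_pos.2 (hpos φ)).ne'
  have hconst (c : ℝ) : ∫ _ in (0 : ℝ)..(Real.pi / 2), c = Real.pi / 2 * c := by simp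
  rw [← hconst, ← hconst]
  constructor
  · refine intervalIntegral.integral_mono (by positivity) (by simp) (hc.intervalIntegrable _ _)
      fun φ => ?_
    refine inv_anti₀ (Real.sqrt_pos.2 (hpos φ)) ?_
    exact Real.sqrt_le_iff.2 ⟨hM.le, (hmem φ).2⟩
  · refine intervalIntegral.integral_mono (by positivity) (hc.intervalIntegrable _ _) (by simp)
      fun φ => ?_
    exact inv_anti₀ hm (Real.le_sqrt_of_sq_le (hmem φ).1)

lemma symmEllipticK_mul {a b c : ℝ} (hc : 0 < c) :
    symmEllipticK (c * a) (c * b) = c⁻¹ * symmEllipticK a b := by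
  rw [symmEllipticK, symmEllipticK, ← intervalIntegral.integral_const_mul]
  congr 1 with φ
  rw [show (c * a) ^ 2 * Real.cos φ ^ 2 + (c * b) ^ 2 * Real.sin φ ^ 2
    = c ^ 2 * (a ^ 2 * Real.cos φ ^ 2 + b ^ 2 * Real.sin φ ^ 2) by ring,
    Real.sqrt_mul (by positivity), Real.sqrt_sq hc.le, mul_inv]

lemma symmEllipticK_sechSum_two_mul {t : ℝ} (ht : 0 < t) :
    symmEllipticK (sechSum t) (altSechSum t) =
      symmEllipticK (sechSum (2 * t)) (altSechSum (2 * t)) := by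
  rw [← symmEllipticK_agm_step (sechSum_pos ht) (altSechSum_pos ht), ← altSechSum_two_mul_sq ht,
    Real.sqrt_sq (altSechSum_pos (by positivity)).le, sechSum_eq_add ht, altSechSum_eq_sub ht]
  congr 1
  ring

/-- The value is unchanged under `t ↦ 2^n t`, while both arguments tend to 1, where the integral is
`π/2`. -/
lemma symmEllipticK_sechSum {t : ℝ} (ht : 0 < t) :
    symmEllipticK (sechSum t) (altSechSum t) = Real.pi / 2 := by
  have hn (n : ℕ) : symmEllipticK (sechSum t) (altSechSum t) =
      symmEllipticK (sechSum (2 ^ n * t)) (altSechSum (2 ^ n * t)) := by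
    induction n with
    | zero => simp
    | succ n ih => rw [ih, symmEllipticK_sechSum_two_mul (by positivity), ← mul_assoc, pow_succ']
  have htop : Tendsto (fun n : ℕ => (2 : ℝ) ^ n * t) atTop atTop :=
    (tendsto_pow_atTop_atTop_of_one_lt one_lt_two).atTop_mul_const ht
  have ha := tendsto_sechSum_atTop.comp htop
  have hb := tendsto_altSechSum_atTop.comp htop
  have hmin := ha.min hb
  have hmax := ha.max hb
  simp only [min_self, max_self] at hmin hmax
  have hbd (n : ℕ) := symmEllipticK_mem_Icc
    (lt_min (sechSum_pos (t := 2 ^ n * t) (by positivity))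
      (altSechSum_pos (t := 2 ^ n * t) (by positivity)))
    ⟨min_le_left _ _, le_max_left (sechSum (2 ^ n * t)) (altSechSum (2 ^ n * t))⟩
    ⟨min_le_right _ _, le_max_right (sechSum (2 ^ n * t)) (altSechSum (2 ^ n * t))⟩
  simp only [← hn] at hbd
  refine le_antisymm (ge_of_tendsto' (x := atTop) ?_ fun n => (hbd n).2)
    (le_of_tendsto' (x := atTop) ?_ fun n => (hbd n).1)
  · simpa using (hmin.inv₀ one_ne_zero).const_mul (Real.pi / 2)
  · simpa using (hmax.inv₀ one_ne_zero).const_mul (Real.pi / 2)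

lemma ellipticK_eq_symmEllipticK {a b k : ℝ} (ha : 0 < a) (hk : k ^ 2 = 1 - (b / a) ^ 2) :
    ellipticK k = a * symmEllipticK a b := by
  have h := symmEllipticK_mul (a := a) (b := b) (inv_pos.2 ha)
  rw [inv_inv] at h
  rw [← h, ellipticK, symmEllipticK]
  congr 1 with φ
  rw [one_div, hk, inv_mul_cancel₀ ha.ne', one_pow, one_mul, Real.cos_sq']
  ring_nf

lemma complementaryModulus_sq {k : ℝ} (hk0 : 0 < k) (hk1 : k < 1) :
    complementaryModulus k ^ 2 = 1 - k ^ 2 :=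
  Real.sq_sqrt (by nlinarith)

/-- The modulus with ratio of periods `α`, together with its complete elliptic integral. -/
lemma exists_isModulusFor {α : ℝ} (hα : 0 < α) :
    ∃ k, IsModulusFor α k ∧ ellipticK k = Real.pi / 2 * sechSum (Real.pi * α) := by
  set t := Real.pi * α with ht
  have ht0 : 0 < t := by positivity
  have ha := sechSum_pos ht0
  have hb := altSechSum_pos ht0
  have hc := halfSechSum_pos ht0
  have hsq := sechSum_sq ht0
  -- Jacobi's identity: the modulus is `c/a`, with complement `b/a`.
  have hk : (halfSechSum t / sechSum t) ^ 2 = 1 - (altSechSum t / sechSum t) ^ 2 := by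
    field_simp
    linarith
  have hk0 : 0 < halfSechSum t / sechSum t := div_pos hc ha
  have hk1 : halfSechSum t / sechSum t < 1 := by
    have : 0 < (altSechSum t / sechSum t) ^ 2 := by positivity
    nlinarith
  have hK : ellipticK (halfSechSum t / sechSum t) = Real.pi / 2 * sechSum t := by
    rw [ellipticK_eq_symmEllipticK ha hk, symmEllipticK_sechSum ht0, mul_comm]
  have hK' : ellipticK (complementaryModulus (halfSechSum t / sechSum t)) =
      α * (Real.pi / 2 * sechSum t) := by
    -- Here `K' = a I(a, c)`, and duality writes `(a, c)` at `t` as `π/t` times `(a, b)` at `π²/t`,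
    -- where the integral is again `π/2`.
    rw [ellipticK_eq_symmEllipticK ha (b := halfSechSum t) (complementaryModulus_sq hk0 hk1)]
    have h := symmEllipticK_mul (a := sechSum (Real.pi ^ 2 / t)) (b := altSechSum (Real.pi ^ 2 / t))
      (c := Real.pi / t) (by positivity)
    rw [← sechSum_eq_dual ht0, ← halfSechSum_eq_dual ht0,
      symmEllipticK_sechSum (by positivity)] at h
    rw [h, ht]
    field_simp
  refine ⟨_, ⟨hk0, hk1, ?_⟩, hK⟩
  rw [hK, hK', mul_div_cancel_right₀]
  positivity

/-! ### Uniqueness of the modulus -/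

lemma one_sub_sq_mul_sin_sq_pos {k : ℝ} (hk0 : 0 < k) (hk1 : k < 1) (φ : ℝ) :
    0 < 1 - k ^ 2 * Real.sin φ ^ 2 := by
  nlinarith [Real.sin_sq_le_one φ, sq_nonneg (Real.sin φ)]

lemma continuous_ellipticK_integrand {k : ℝ} (hk0 : 0 < k) (hk1 : k < 1) :
    Continuous fun φ : ℝ => 1 / Real.sqrt (1 - k ^ 2 * Real.sin φ ^ 2) :=
  Continuous.div continuous_const (by fun_prop) fun φ =>
    (Real.sqrt_pos.2 (one_sub_sq_mul_sin_sq_pos hk0 hk1 φ)).ne'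

lemma ellipticK_pos {k : ℝ} (hk0 : 0 < k) (hk1 : k < 1) : 0 < ellipticK k :=
  intervalIntegral.intervalIntegral_pos_of_pos
    ((continuous_ellipticK_integrand hk0 hk1).intervalIntegrable _ _)
    (fun φ => one_div_pos.2 (Real.sqrt_pos.2 (one_sub_sq_mul_sin_sq_pos hk0 hk1 φ)))
    (by positivity)

lemma ellipticK_strictMonoOn : StrictMonoOn ellipticK (Ioo 0 1) := by
  intro k hk l hl hkl
  have hsq : k ^ 2 < l ^ 2 := pow_lt_pow_left₀ hkl hk.1.le two_ne_zero
  refine intervalIntegral.integral_lt_integral_of_continuousOn_of_le_of_exists_lt (by positivity)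
    (continuous_ellipticK_integrand hk.1 hk.2).continuousOn
    (continuous_ellipticK_integrand hl.1 hl.2).continuousOn (fun φ _ => ?_)
    ⟨Real.pi / 2, ⟨by positivity, le_rfl⟩, ?_⟩
  · refine one_div_le_one_div_of_le
      (Real.sqrt_pos.2 (one_sub_sq_mul_sin_sq_pos hl.1 hl.2 φ)) (Real.sqrt_le_sqrt ?_)
    nlinarith [sq_nonneg (Real.sin φ)]
  · refine one_div_lt_one_div_of_lt
      (Real.sqrt_pos.2 (one_sub_sq_mul_sin_sq_pos hl.1 hl.2 _))
      (Real.sqrt_lt_sqrt (one_sub_sq_mul_sin_sq_pos hl.1 hl.2 _).le ?_)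
    rw [Real.sin_pi_div_two]
    linarith

lemma complementaryModulus_mem_Ioo {k : ℝ} (hk : k ∈ Ioo (0 : ℝ) 1) :
    complementaryModulus k ∈ Ioo (0 : ℝ) 1 := by
  have h := hk.1
  have h2 := hk.2
  refine ⟨Real.sqrt_pos.2 (by nlinarith), (Real.sqrt_lt' one_pos).2 (by nlinarith)⟩

lemma period_ratio_strictAntiOn :
    StrictAntiOn (fun k => ellipticK (complementaryModulus k) / ellipticK k) (Ioo 0 1) := by
  intro k hk l hl hkl
  have hl' := complementaryModulus_mem_Ioo hl
  have h1 : complementaryModulus l < complementaryModulus k := by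
    have h := hk.1
    have h2 := hl.2
    exact Real.sqrt_lt_sqrt (by nlinarith) (by nlinarith)
  exact div_lt_div₀ (ellipticK_strictMonoOn hl' (complementaryModulus_mem_Ioo hk) h1)
    (ellipticK_strictMonoOn hk hl hkl).le (ellipticK_pos (complementaryModulus_mem_Ioo hk).1 (complementaryModulus_mem_Ioo hk).2).le
    (ellipticK_pos hk.1 hk.2)

lemma IsModulusFor.unique {α k l : ℝ} (hk : IsModulusFor α k) (hl : IsModulusFor α l) : k = l :=
  period_ratio_strictAntiOn.injOn ⟨hk.1, hk.2.1⟩ ⟨hl.1, hl.2.1⟩ (hk.2.2.symm.trans hl.2.2)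

/-! ### Mean values in the presence of simple poles -/

/-- The residues of `1/(z(z-s))` at `0` and `s` cancel. Principal parts therefore do not affect the
mean. -/
lemma circleAverage_inv_sub {R : ℝ} {s : ℂ} (hs : s ∈ Metric.ball (0 : ℂ) R) (hs0 : s ≠ 0) :
    Real.circleAverage (fun z => (z - s)⁻¹) 0 R = 0 := by
  have hR : 0 < R := Metric.pos_of_mem_ball hs
  have hsph (w : ℂ) (hw : w ∈ Metric.ball (0 : ℂ) R) (z : ℂ) (hz : z ∈ Metric.sphere (0 : ℂ) R) :
      z - w ≠ 0 := by
    rw [sub_ne_zero]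
    rintro rfl
    rw [Metric.mem_ball] at hw
    exact hw.ne hz
  have hint (w : ℂ) (hw : w ∈ Metric.ball (0 : ℂ) R) : CircleIntegrable (fun z => (z - w)⁻¹) 0 R :=
    ContinuousOn.circleIntegrable hR.le
      ((continuousOn_id.sub continuousOn_const).inv₀ (hsph w hw))
  have h0 : (0 : ℂ) ∈ Metric.ball (0 : ℂ) R := Metric.mem_ball_self hR
  rw [Real.circleAverage_eq_circleIntegral hR.ne']
  have : (∮ z in C(0, R), (z - 0)⁻¹ • (z - s)⁻¹) =
      ∮ z in C(0, R), s⁻¹ * ((z - s)⁻¹ - (z - 0)⁻¹) := by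
    refine circleIntegral.integral_congr hR.le fun z hz => ?_
    have h1 := hsph s hs z hz
    have h2 := hsph 0 h0 z hz
    simp only [smul_eq_mul]
    field_simp
    ring
  rw [this, circleIntegral.integral_const_mul, circleIntegral.integral_sub (hint s hs) (hint 0 h0),
    circleIntegral.integral_sub_inv_of_mem_ball hs, circleIntegral.integral_sub_inv_of_mem_ball h0]
  simp

/-- The reciprocal of an analytic function with a simple zero has a simple pole. -/
lemma exists_analyticAt_inv_sub_pole {g : ℂ → ℂ} {s : ℂ} (hg : AnalyticAt ℂ g s) (hs : g s = 0)
    (hd : deriv g s ≠ 0) :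
    ∃ H : ℂ → ℂ, AnalyticAt ℂ H s ∧
      ∀ᶠ z in 𝓝[≠] s, (g z)⁻¹ - (deriv g s)⁻¹ * (z - s)⁻¹ = H z := by
  have hG : AnalyticAt ℂ (dslope g s) s := by
    obtain ⟨p, hp⟩ := hg
    exact hp.has_fpower_series_dslope_fslope.analyticAt
  have hG0 : dslope g s s ≠ 0 := by rwa [dslope_same]
  have hi : AnalyticAt ℂ (dslope g s)⁻¹ s := hG.inv hG0
  -- Write `g = (z-s)G` with `G = dslope g s`; the remainder is the difference quotient of `1/G` at
  -- `s`.
  refine ⟨dslope (dslope g s)⁻¹ s, ?_, ?_⟩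
  · obtain ⟨p, hp⟩ := hi
    exact hp.has_fpower_series_dslope_fslope.analyticAt
  · filter_upwards [self_mem_nhdsWithin] with z hz
    have hz' : z ≠ s := hz
    rw [dslope_of_ne _ hz', slope_def_field, Pi.inv_apply, Pi.inv_apply, dslope_same,
      dslope_of_ne _ hz', slope_def_field, hs, sub_zero, inv_div]
    have := sub_ne_zero.2 hz'
    field_simp

/-- Mean value of the reciprocal of an analytic function with finitely many simple zeros. -/
lemma circleAverage_inv_of_simple_zeros {g : ℂ → ℂ} {R : ℝ} (hR : 0 < R) {S : Finset ℂ}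
    (hg : ∀ z ∈ Metric.closedBall (0 : ℂ) R, AnalyticAt ℂ g z)
    (hS : ∀ s ∈ S, s ∈ Metric.ball (0 : ℂ) R) (hS0 : (0 : ℂ) ∉ S)
    (hgS : ∀ s ∈ S, g s = 0) (hdS : ∀ s ∈ S, deriv g s ≠ 0)
    (hz : ∀ z ∈ Metric.closedBall (0 : ℂ) R, z ∉ S → g z ≠ 0) :
    Real.circleAverage (fun z => (g z)⁻¹) 0 R =
      (g 0)⁻¹ + ∑ s ∈ S, (deriv g s)⁻¹ * s⁻¹ := by
  classical
  set h : ℂ → ℂ := fun z => (g z)⁻¹ - ∑ s ∈ S, (deriv g s)⁻¹ * (z - s)⁻¹ with hh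
  have hpole (s w : ℂ) (hsw : w ≠ s) : AnalyticAt ℂ (fun z => (deriv g s)⁻¹ * (z - s)⁻¹) w :=
    analyticAt_const.mul ((analyticAt_id.sub analyticAt_const).inv (sub_ne_zero.2 hsw))
  have hex : ∀ s ∈ S, ∃ H : ℂ → ℂ, AnalyticAt ℂ H s ∧ ∀ᶠ z in 𝓝[≠] s, h z = H z := by
    intro s hs
    obtain ⟨H, hH, hHe⟩ := exists_analyticAt_inv_sub_pole
      (hg s (Metric.ball_subset_closedBall (hS s hs))) (hgS s hs) (hdS s hs)
    refine ⟨fun z => H z - ∑ w ∈ S.erase s, (deriv g w)⁻¹ * (z - w)⁻¹, ?_, ?_⟩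
    · exact hH.sub (Finset.analyticAt_fun_sum _ fun w hw => hpole w s (Finset.ne_of_mem_erase hw).symm)
    · filter_upwards [hHe] with z hz
      rw [hh, ← hz]
      beta_reduce
      rw [← Finset.add_sum_erase S _ hs]
      ring
  choose! H hHan hHeq using hex
  -- `h` is `1/g` without its principal parts. `E` corrects its values on `S`, making it analytic on
  -- the closed disc, so its mean is `h 0`.
  set E : ℂ → ℂ := fun z => if z ∈ S then H z z else h z with hE
  have hEoff : ∀ z, z ∉ S → E z = h z := fun z hz => if_neg hz
  have hopen : IsOpen ((S : Set ℂ)ᶜ) := S.finite_toSet.isClosed.isOpen_compl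
  have hEan : ∀ z ∈ Metric.closedBall (0 : ℂ) R, AnalyticAt ℂ E z := by
    intro z hzR
    by_cases hzS : z ∈ S
    · refine (hHan z hzS).congr ?_
      have h1 : ∀ᶠ w in 𝓝[≠] z, w ∉ S := by
        have := (S.erase z).finite_toSet.isClosed.isOpen_compl.mem_nhds (x := z) (by simp)
        filter_upwards [self_mem_nhdsWithin, mem_nhdsWithin_of_mem_nhds this] with w hw hw2 hw3
        exact hw2 (Finset.mem_coe.2 (Finset.mem_erase.2 ⟨hw, hw3⟩))
      have h2 : ∀ᶠ w in 𝓝[≠] z, H z w = E w := by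
        filter_upwards [h1, hHeq z hzS] with w hw1 hw2
        rw [hEoff w hw1, hw2]
      rw [eventually_nhdsWithin_iff] at h2
      filter_upwards [h2] with w hw
      by_cases hwz : w = z
      · rw [hwz, hE]; simp [hzS]
      · exact hw hwz
    · have h1 : AnalyticAt ℂ h z :=
        ((hg z hzR).inv (hz z hzR hzS)).sub (Finset.analyticAt_fun_sum _ fun w hw =>
          hpole w z fun e => hzS (e ▸ hw))
      refine h1.congr ?_
      filter_upwards [hopen.mem_nhds (show z ∈ (S : Set ℂ)ᶜ from hzS)] with w hw
      exact (hEoff w hw).symm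
  have havg : Real.circleAverage E 0 R = E 0 := by
    refine circleAverage_of_differentiable_on_off_countable countable_empty ?_ ?_
    · rw [abs_of_pos hR]
      exact fun z hz => (hEan z hz).continuousAt.continuousWithinAt
    · rw [abs_of_pos hR]
      exact fun z hz => (hEan z (Metric.ball_subset_closedBall hz.1)).differentiableAt
  have hsphS : ∀ z ∈ Metric.sphere (0 : ℂ) R, z ∉ S := fun z hz hzS => by
    have := hS z hzS
    rw [Metric.mem_ball] at this
    exact this.ne hz
  have havg2 : Real.circleAverage E 0 R = Real.circleAverage h 0 R := by
    refine Real.circleAverage_congr_sphere fun z hz => ?_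
    rw [abs_of_pos hR] at hz
    exact hEoff z (hsphS z hz)
  have hci1 : CircleIntegrable (fun z => (g z)⁻¹) 0 R := by
    refine ContinuousOn.circleIntegrable hR.le fun z hzs => ?_
    have hzb := Metric.sphere_subset_closedBall hzs
    exact ((hg z hzb).inv (hz z hzb (hsphS z hzs))).continuousAt.continuousWithinAt
  have hci2 : ∀ s ∈ S, CircleIntegrable (fun z => (deriv g s)⁻¹ * (z - s)⁻¹) 0 R := by
    intro s hs
    refine ContinuousOn.circleIntegrable hR.le fun z hzs => ?_
    exact (hpole s z fun e => hsphS z hzs (e ▸ hs)).continuousAt.continuousWithinAt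
  have hsum : Real.circleAverage (fun z => ∑ s ∈ S, (deriv g s)⁻¹ * (z - s)⁻¹) 0 R = 0 := by
    rw [Real.circleAverage_fun_sum hci2]
    refine Finset.sum_eq_zero fun s hs => ?_
    have := Real.circleAverage_fun_smul (a := (deriv g s)⁻¹) (f := fun z : ℂ => (z - s)⁻¹)
      (c := 0) (R := R)
    simp only [smul_eq_mul] at this
    rw [this, circleAverage_inv_sub (hS s hs) fun e => hS0 (e ▸ hs), mul_zero]
  have hsub := Real.circleAverage_fun_sub hci1 (CircleIntegrable.fun_sum S hci2)
  rw [hsum, sub_zero] at hsub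
  rw [← hsub, ← hh, ← havg2, havg, hEoff 0 hS0, hh]
  beta_reduce
  rw [sub_eq_add_neg, ← Finset.sum_neg_distrib]
  simp only [zero_sub, inv_neg, mul_neg, neg_neg]

/-! ### Zeros of `cosLog` and circles avoiding them -/

/-- The function `u ↦ cos (log (1 + u) / (2 α))`. -/
noncomputable def cosLog (α : ℝ) (u : ℂ) : ℂ := Complex.cos (Complex.log (1 + u) / (2 * α))

lemma one_add_mem_slitPlane {u : ℂ} (hu : ‖u‖ < 1) : 1 + u ∈ Complex.slitPlane := by
  left
  have := (abs_le.1 (Complex.abs_re_le_norm u)).1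
  simp only [Complex.add_re, Complex.one_re]
  linarith

lemma hasDerivAt_cosLog {α : ℝ} {u : ℂ} (hu : 1 + u ∈ Complex.slitPlane) :
    HasDerivAt (cosLog α)
      (-Complex.sin (Complex.log (1 + u) / (2 * α)) * ((1 + u)⁻¹ / (2 * α))) u := by
  have h := (((hasDerivAt_id u).const_add 1).clog hu).div_const (2 * (α : ℂ))
  have h2 := h.ccos
  simpa [cosLog, one_div] using! h2

lemma analyticAt_cosLog {α : ℝ} {u : ℂ} (hu : 1 + u ∈ Complex.slitPlane) :
    AnalyticAt ℂ (cosLog α) u := by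
  refine DifferentiableOn.analyticAt (s := (fun u : ℂ => 1 + u) ⁻¹' Complex.slitPlane)
    (fun v hv => (hasDerivAt_cosLog hv).differentiableAt.differentiableWithinAt) ?_
  exact (Complex.isOpen_slitPlane.preimage (by fun_prop)).mem_nhds hu

/-- This is `|cos(x+iy)|² = cos² x + sinh² y`; the modulus and the argument of `1 + u` can then be
bounded separately. -/
lemma norm_sq_cosLog (α : ℝ) (u : ℂ) :
    ‖cosLog α u‖ ^ 2 = Real.cos (Real.log ‖1 + u‖ / (2 * α)) ^ 2 +
      Real.sinh (Complex.arg (1 + u) / (2 * α)) ^ 2 := by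
  have h : Complex.log (1 + u) / (2 * α) = ((Real.log ‖1 + u‖ / (2 * α) : ℝ) : ℂ) +
      ((Complex.arg (1 + u) / (2 * α) : ℝ) : ℂ) * Complex.I := by
    rw [Complex.log]; push_cast; ring
  rw [cosLog, h, Complex.cos_add_mul_I, ← Complex.normSq_eq_norm_sq, Complex.normSq_apply,
    ← Complex.ofReal_cos, ← Complex.ofReal_sin, ← Complex.ofReal_cosh, ← Complex.ofReal_sinh]
  simp only [Complex.sub_re, Complex.sub_im, Complex.mul_re, Complex.mul_im, Complex.ofReal_re,
    Complex.ofReal_im, Complex.I_re, Complex.I_im]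
  generalize Real.log ‖1 + u‖ / (2 * α) = x
  generalize Complex.arg (1 + u) / (2 * α) = y
  linear_combination Real.cos x ^ 2 * Real.cosh_sq y + Real.sinh y ^ 2 * Real.sin_sq x

/-- The radii of circles that avoid the zeros of `cosLog`. -/
noncomputable def cosLogRadius (α : ℝ) (N : ℕ) : ℝ := 1 - Real.exp (-(2 * Real.pi * α * N))

section

variable {α : ℝ}

lemma pos_of_log_two_div_pi_lt (hα : Real.log 2 / Real.pi < α) : 0 < α :=
  (by positivity : 0 < Real.log 2 / Real.pi).trans hα

lemma log_two_lt_pi_mul (hα : Real.log 2 / Real.pi < α) : Real.log 2 < Real.pi * α := by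
  rwa [div_lt_iff₀' Real.pi_pos] at hα

lemma cosLogRadius_lt_one (α : ℝ) (N : ℕ) : cosLogRadius α N < 1 :=
  sub_lt_self _ (Real.exp_pos _)

lemma half_le_cosLogRadius (hα : Real.log 2 / Real.pi < α) {N : ℕ} (hN : 1 ≤ N) :
    1 / 2 ≤ cosLogRadius α N := by
  have h0 := pos_of_log_two_div_pi_lt hα
  have h1 := log_two_lt_pi_mul hα
  have hN' : (1 : ℝ) ≤ N := by exact_mod_cast hN
  have h2 : Real.exp (-(2 * Real.pi * α * N)) ≤ Real.exp (-Real.log 2) := by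
    refine Real.exp_le_exp.2 (neg_le_neg ?_)
    have : 0 < Real.pi * α := by positivity
    nlinarith
  rw [Real.exp_neg (Real.log 2), Real.exp_log two_pos] at h2
  rw [cosLogRadius]
  linarith

/-- A uniform lower bound for `cosLog` on the chosen circles. -/
lemma exists_le_norm_sq_cosLog (hα : Real.log 2 / Real.pi < α) :
    ∃ c : ℝ, 0 < c ∧ ∀ N : ℕ, 1 ≤ N → ∀ u : ℂ, ‖u‖ = cosLogRadius α N → c ≤ ‖cosLog α u‖ ^ 2 := by
  have h0 := pos_of_log_two_div_pi_lt hα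
  have hl := log_two_lt_pi_mul hα
  have hlog2 : 0 < Real.log 2 := Real.log_pos one_lt_two
  set A := Real.log 2 / (2 * α) with hA
  have hA0 : 0 < A := by positivity
  have hA1 : A < Real.pi / 2 := by
    rw [hA, div_lt_iff₀ (by positivity)]; linarith
  -- Chosen so that `1 - 4η = e^{-2απ/3}`: if `1 - cos φ ≤ η` and `ρ < 1`, then `log ρ/(2α)` is
  -- within `π/3` of `-Nπ`, where `cos² = 1`.
  set η := (1 - Real.exp (-(2 * α * (Real.pi / 3)))) / 4 with hη
  have hη0 : 0 < η := by
    have : Real.exp (-(2 * α * (Real.pi / 3))) < 1 := by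
      rw [Real.exp_lt_one_iff, neg_lt_zero]; positivity
    rw [hη]; linarith
  have hcA : 0 < Real.cos A := Real.cos_pos_of_mem_Ioo ⟨by linarith, hA1⟩
  refine ⟨min (Real.cos A ^ 2) (min (1 / 4) (η / (2 * α ^ 2))), by positivity, ?_⟩
  intro N hN u hu
  rw [norm_sq_cosLog]
  set r := cosLogRadius α N with hr
  set ρ := ‖1 + u‖ with hρ
  set φ := Complex.arg (1 + u) with hφ
  have hr1 : r < 1 := cosLogRadius_lt_one α N
  have hr2 : 1 / 2 ≤ r := half_le_cosLogRadius hα hN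
  have hs : 1 - r = Real.exp (-(2 * Real.pi * α * N)) := by rw [hr, cosLogRadius]; ring
  have hρ1 : 1 - r ≤ ρ := by
    have := norm_sub_norm_le (1 : ℂ) (-u)
    rw [norm_one, norm_neg, hu, sub_neg_eq_add] at this
    exact this
  have hρ2 : ρ ≤ 1 + r := by
    have := norm_add_le (1 : ℂ) u
    rwa [norm_one, hu] at this
  have hρ0 : 0 < ρ := by linarith
  have hcos : ρ * Real.cos φ = (1 + u).re := by rw [hρ, hφ, Complex.norm_mul_cos_arg]
  -- The law of cosines in the triangle `0, 1, 1+u`.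
  have hkey : (ρ - (1 - r)) * (1 + r - ρ) = 2 * ρ * (1 - Real.cos φ) := by
    have h1 : ρ ^ 2 = (1 + u.re) ^ 2 + u.im ^ 2 := by
      rw [hρ, ← Complex.normSq_eq_norm_sq, Complex.normSq_apply]; simp; ring
    have h2 : r ^ 2 = u.re ^ 2 + u.im ^ 2 := by
      rw [← hu, ← Complex.normSq_eq_norm_sq, Complex.normSq_apply]; ring
    simp only [Complex.add_re, Complex.one_re] at hcos
    nlinarith
  rcases le_or_gt 1 ρ with hcase | hcase
  · have ha0 : 0 ≤ Real.log ρ / (2 * α) := div_nonneg (Real.log_nonneg hcase) (by positivity)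
    have ha1 : Real.log ρ / (2 * α) ≤ A :=
      div_le_div_of_nonneg_right (Real.log_le_log hρ0 (by linarith)) (by positivity)
    have := Real.cos_le_cos_of_nonneg_of_le_pi ha0 (by linarith [Real.pi_pos]) ha1
    refine (min_le_left _ _).trans ?_
    nlinarith [sq_nonneg (Real.sinh (φ / (2 * α)))]
  · refine (min_le_right _ _).trans ?_
    rcases le_or_gt (1 - Real.cos φ) η with hφη | hφη
    · refine (min_le_left _ _).trans ?_
      have h1 : ρ - (1 - r) ≤ 4 * ρ * (1 - Real.cos φ) := by
        nlinarith [mul_nonneg (sub_nonneg.2 hρ1) (show (0 : ℝ) ≤ 1 + r - ρ - 1 / 2 by linarith)]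
      have h2 : ρ * Real.exp (-(2 * α * (Real.pi / 3))) ≤ Real.exp (-(2 * Real.pi * α * N)) := by
        have : Real.exp (-(2 * α * (Real.pi / 3))) = 1 - 4 * η := by rw [hη]; ring
        rw [← hs, this]
        nlinarith
      have h3 : Real.log ρ - 2 * α * (Real.pi / 3) ≤ -(2 * Real.pi * α * N) := by
        have := Real.log_le_log (by positivity) h2
        rw [Real.log_mul hρ0.ne' (Real.exp_ne_zero _), Real.log_exp, Real.log_exp] at this
        linarith
      have h4 : -(2 * Real.pi * α * N) ≤ Real.log ρ := by
        rw [Real.le_log_iff_exp_le hρ0, ← hs]; exact hρ1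
      have h5 : Real.cos (Real.log ρ / (2 * α)) ^ 2 =
          Real.cos (Real.log ρ / (2 * α) + N * Real.pi) ^ 2 := by
        rw [Real.cos_add_nat_mul_pi, mul_pow, ← pow_mul, mul_comm N 2, pow_mul]; simp
      have h6 : 0 ≤ Real.log ρ / (2 * α) + N * Real.pi := by
        have : Real.log ρ / (2 * α) + N * Real.pi = (Real.log ρ + 2 * Real.pi * α * N) / (2 * α) := by
          field_simp
        rw [this]
        exact div_nonneg (by linarith) (by positivity)
      have h7 : Real.log ρ / (2 * α) + N * Real.pi ≤ Real.pi / 3 := by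
        have : Real.log ρ / (2 * α) + N * Real.pi = (Real.log ρ + 2 * Real.pi * α * N) / (2 * α) := by
          field_simp
        rw [this, div_le_iff₀ (by positivity)]
        linarith
      have h8 := Real.cos_le_cos_of_nonneg_of_le_pi h6 (by linarith [Real.pi_pos]) h7
      rw [Real.cos_pi_div_three] at h8
      rw [h5]
      nlinarith [sq_nonneg (Real.sinh (φ / (2 * α)))]
    -- The argument stays away from 0, so the `sinh` term alone gives the bound.
    · refine (min_le_right _ _).trans ?_
      have h1 := Real.one_sub_sq_div_two_le_cos (x := φ)
      have h2 : 2 * η ≤ φ ^ 2 := by linarith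
      have h3 : (φ / (2 * α)) ^ 2 ≤ Real.sinh (φ / (2 * α)) ^ 2 := by
        rw [← sq_abs, ← sq_abs (Real.sinh _), Real.abs_sinh]
        exact pow_le_pow_left₀ (abs_nonneg _) (Real.self_le_sinh_iff.2 (abs_nonneg _)) 2
      have h4 : η / (2 * α ^ 2) ≤ (φ / (2 * α)) ^ 2 := by
        rw [div_pow, div_le_div_iff₀ (by positivity) (by positivity)]
        nlinarith [mul_le_mul_of_nonneg_right h2 (sq_nonneg α)]
      nlinarith [sq_nonneg (Real.cos (Real.log ρ / (2 * α)))]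

/-- The zeros of `cosLog` in the unit disc. -/
noncomputable def cosLogZero (α : ℝ) (n : ℕ) : ℂ :=
  ((Real.exp (-(Real.pi * α * (2 * n + 1))) - 1 : ℝ) : ℂ)

lemma one_add_cosLogZero (α : ℝ) (n : ℕ) :
    1 + cosLogZero α n = ((Real.exp (-(Real.pi * α * (2 * n + 1))) : ℝ) : ℂ) := by
  rw [cosLogZero]; push_cast; ring

lemma log_one_add_cosLogZero (h0 : 0 < α) (n : ℕ) :
    Complex.log (1 + cosLogZero α n) / (2 * α) = ((-(n * Real.pi + Real.pi / 2) : ℝ) : ℂ) := by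
  have h : (α : ℂ) ≠ 0 := by exact_mod_cast h0.ne'
  rw [one_add_cosLogZero, ← Complex.ofReal_log (Real.exp_pos _).le, Real.log_exp]
  push_cast
  field_simp

lemma cosLog_cosLogZero (h0 : 0 < α) (n : ℕ) : cosLog α (cosLogZero α n) = 0 := by
  rw [cosLog, log_one_add_cosLogZero h0, ← Complex.ofReal_cos, Real.cos_neg,
    Real.cos_add_pi_div_two, Real.sin_nat_mul_pi]
  simp

lemma deriv_cosLog_cosLogZero (h0 : 0 < α) (n : ℕ) :
    deriv (cosLog α) (cosLogZero α n) =
      (((-1) ^ n * (Real.exp (-(Real.pi * α * (2 * n + 1))))⁻¹ / (2 * α) : ℝ) : ℂ) := by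
  have hm : 1 + cosLogZero α n ∈ Complex.slitPlane := by
    rw [one_add_cosLogZero, Complex.ofReal_mem_slitPlane]; positivity
  rw [(hasDerivAt_cosLog hm).deriv, log_one_add_cosLogZero h0, ← Complex.ofReal_sin, Real.sin_neg,
    Real.sin_add_pi_div_two, Real.cos_nat_mul_pi, one_add_cosLogZero]
  push_cast
  ring

lemma cosLogZero_injective (h0 : 0 < α) : Function.Injective (cosLogZero α) := by
  intro m n h
  rw [cosLogZero, cosLogZero, Complex.ofReal_inj, sub_left_inj, Real.exp_eq_exp, neg_inj] at h
  have := mul_left_cancel₀ (by positivity) h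
  have : (m : ℝ) = n := by linarith
  exact_mod_cast this

lemma norm_cosLogZero (h0 : 0 < α) (n : ℕ) :
    ‖cosLogZero α n‖ = 1 - Real.exp (-(Real.pi * α * (2 * n + 1))) := by
  rw [cosLogZero, Complex.norm_real, Real.norm_of_nonpos, neg_sub]
  rw [sub_nonpos, Real.exp_le_one_iff, neg_nonpos]
  positivity

lemma exists_eq_cosLogZero (hα : Real.log 2 / Real.pi < α) {N : ℕ} {u : ℂ}
    (hu : ‖u‖ ≤ cosLogRadius α N) (hz : cosLog α u = 0) : ∃ n < N, u = cosLogZero α n := by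
  have h0 := pos_of_log_two_div_pi_lt hα
  have hl := log_two_lt_pi_mul hα
  have hu1 : ‖u‖ < 1 := hu.trans_lt (cosLogRadius_lt_one α N)
  have hne := Complex.slitPlane_ne_zero (one_add_mem_slitPlane hu1)
  have hpos : 0 < ‖1 + u‖ := norm_pos_iff.2 hne
  obtain ⟨k, hk⟩ := Complex.cos_eq_zero_iff.1 hz
  have hα' : (α : ℂ) ≠ 0 := by exact_mod_cast h0.ne'
  have hlog : Complex.log (1 + u) = (((2 * k + 1) * (Real.pi * α) : ℝ) : ℂ) := by
    push_cast
    field_simp at hk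
    linear_combination hk
  have hre : Real.log ‖1 + u‖ = (2 * k + 1) * (Real.pi * α) := by
    rw [← Complex.log_re, hlog, Complex.ofReal_re]
  -- The bound on `α` excludes the zeros with `k ≥ 0`; the radius, through `h2`, limits the negative
  -- ones.
  have h1 : Real.log ‖1 + u‖ < Real.pi * α := by
    refine lt_of_le_of_lt (Real.log_le_log hpos ?_) hl
    have := norm_add_le (1 : ℂ) u
    rw [norm_one] at this
    linarith
  have h2 : -(2 * Real.pi * α * N) ≤ Real.log ‖1 + u‖ := by
    rw [Real.le_log_iff_exp_le hpos]
    have := norm_sub_norm_le (1 : ℂ) (-u)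
    rw [norm_one, norm_neg, sub_neg_eq_add] at this
    rw [cosLogRadius] at hu
    linarith
  have hpa : 0 < Real.pi * α := by positivity
  rw [hre] at h1 h2
  have h3 : (2 * k + 1 : ℝ) < 1 := by nlinarith
  have h4 : -(2 * N : ℝ) ≤ 2 * k + 1 := by
    by_contra hcon
    push Not at hcon
    nlinarith
  have h3' : 2 * k + 1 < 1 := by exact_mod_cast h3
  have h4' : -(2 * (N : ℤ)) ≤ 2 * k + 1 := by exact_mod_cast h4
  obtain ⟨n, hn⟩ : ∃ n : ℕ, k = -(n : ℤ) - 1 := ⟨(-k - 1).toNat, by omega⟩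
  refine ⟨n, by omega, ?_⟩
  have h5 := Complex.exp_log hne
  rw [hlog, ← Complex.ofReal_exp] at h5
  have h6 : (2 * k + 1 : ℝ) * (Real.pi * α) = -(Real.pi * α * (2 * n + 1)) := by
    rw [hn]; push_cast; ring
  rw [h6, ← one_add_cosLogZero] at h5
  exact (add_left_cancel h5).symm

/-- The circle encloses exactly the first `N` zeros, since its leftmost point has `log(1+u) =
-2παN`, midway between consecutive zeros. -/
lemma circleAverage_inv_cosLog (hα : Real.log 2 / Real.pi < α) {N : ℕ} (hN : 1 ≤ N) :
    Real.circleAverage (fun u => (cosLog α u)⁻¹) 0 (cosLogRadius α N) =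
      ((1 - 2 * α * ∑ n ∈ Finset.range N,
        (-1) ^ n * (Real.exp (Real.pi * α * (2 * n + 1)) - 1)⁻¹ : ℝ) : ℂ) := by
  have h0 := pos_of_log_two_div_pi_lt hα
  have hpa : 0 < Real.pi * α := by positivity
  have hexp (n : ℕ) : Real.exp (-(Real.pi * α * (2 * n + 1))) < 1 := by
    rw [Real.exp_lt_one_iff, neg_lt_zero]; positivity
  have hd (n : ℕ) : deriv (cosLog α) (cosLogZero α n) ≠ 0 := by
    rw [deriv_cosLog_cosLogZero h0, Complex.ofReal_ne_zero]
    exact div_ne_zero (mul_ne_zero (pow_ne_zero _ (by norm_num)) (by positivity)) (by positivity)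
  rw [circleAverage_inv_of_simple_zeros (S := (Finset.range N).image (cosLogZero α))
    (by linarith [half_le_cosLogRadius hα hN]),
    Finset.sum_image (cosLogZero_injective h0).injOn]
  · have h1 : cosLog α 0 = 1 := by simp [cosLog]
    rw [h1, Finset.mul_sum, sub_eq_add_neg, ← Finset.sum_neg_distrib]
    push_cast
    rw [inv_one]
    congr 1
    refine Finset.sum_congr rfl fun n _ => ?_
    rw [deriv_cosLog_cosLogZero h0, cosLogZero]
    have h2 : Real.exp (-(Real.pi * α * (2 * n + 1))) - 1 ≠ 0 := by linarith [hexp n]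
    have h3 : Real.exp (Real.pi * α * (2 * n + 1)) - 1 ≠ 0 := by
      have := Real.one_lt_exp_iff.2 (show 0 < Real.pi * α * (2 * n + 1) by positivity)
      linarith
    have h4 : Real.exp (Real.pi * α * (2 * n + 1)) * Real.exp (-(Real.pi * α * (2 * n + 1))) = 1 := by
      rw [← Real.exp_add]; simp
    have h5 : ((-1 : ℝ) ^ n) * (-1) ^ n = 1 := by rw [← mul_pow]; simp
    have key : (((-1) ^ n * (Real.exp (-(Real.pi * α * (2 * n + 1))))⁻¹ / (2 * α) : ℝ))⁻¹ *
        (Real.exp (-(Real.pi * α * (2 * n + 1))) - 1)⁻¹ =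
        -(2 * α * ((-1) ^ n * (Real.exp (Real.pi * α * (2 * n + 1)) - 1)⁻¹)) := by
      have h6 : ((-1 : ℝ) ^ n)⁻¹ = (-1) ^ n := by rw [← inv_pow]; norm_num
      have h7 : Real.exp (-(Real.pi * α * (2 * n + 1))) *
          (Real.exp (-(Real.pi * α * (2 * n + 1))) - 1)⁻¹ =
          -(Real.exp (Real.pi * α * (2 * n + 1)) - 1)⁻¹ := by
        field_simp
        linear_combination h4
      rw [inv_div, div_eq_mul_inv, mul_inv, inv_inv, h6]
      linear_combination 2 * α * (-1) ^ n * h7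
    have := congrArg (fun x : ℝ => (x : ℂ)) key
    push_cast at this ⊢
    exact this
  · intro z hz
    rw [mem_closedBall_zero_iff] at hz
    exact analyticAt_cosLog (one_add_mem_slitPlane (hz.trans_lt (cosLogRadius_lt_one α N)))
  · intro s hs
    obtain ⟨n, hn, rfl⟩ := Finset.mem_image.1 hs
    rw [mem_ball_zero_iff, norm_cosLogZero h0, cosLogRadius, sub_lt_sub_iff_left, Real.exp_lt_exp]
    have : (n + 1 : ℝ) ≤ N := by exact_mod_cast Finset.mem_range.1 hn
    nlinarith
  · intro hs
    obtain ⟨n, -, hn⟩ := Finset.mem_image.1 hs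
    have := norm_cosLogZero h0 n
    rw [hn, norm_zero] at this
    linarith [hexp n]
  · intro s hs
    obtain ⟨n, hn, rfl⟩ := Finset.mem_image.1 hs
    exact cosLog_cosLogZero h0 n
  · intro s hs
    obtain ⟨n, hn, rfl⟩ := Finset.mem_image.1 hs
    exact hd n
  · intro z hz hzS hz0
    rw [mem_closedBall_zero_iff] at hz
    obtain ⟨n, hn, rfl⟩ := exists_eq_cosLogZero hα hz hz0
    exact hzS (Finset.mem_image_of_mem _ (Finset.mem_range.2 hn))

end

/-! ### Passage to the unit circle -/

section

variable {α : ℝ}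

lemma tendsto_cosLogRadius (h0 : 0 < α) : Tendsto (cosLogRadius α) atTop (𝓝 1) := by
  have h1 : Tendsto (fun N : ℕ => 2 * Real.pi * α * (N : ℝ)) atTop atTop :=
    tendsto_natCast_atTop_atTop.const_mul_atTop (by positivity)
  simpa [cosLogRadius] using! (Real.tendsto_exp_neg_atTop_nhds_zero.comp h1).const_sub 1

lemma one_add_mem_slitPlane_of_norm_eq_one {u : ℂ} (hu : ‖u‖ = 1) (hu1 : u ≠ -1) :
    1 + u ∈ Complex.slitPlane := by
  left
  have h1 := (abs_le.1 (Complex.abs_re_le_norm u)).1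
  rw [hu] at h1
  simp only [Complex.add_re, Complex.one_re]
  refine lt_of_le_of_ne (by linarith) fun h => hu1 ?_
  have h2 : u.re = -1 := by linarith
  have h3 : u.re ^ 2 + u.im ^ 2 = 1 := by
    have : ‖u‖ ^ 2 = 1 := by rw [hu]; norm_num
    rw [← Complex.normSq_eq_norm_sq, Complex.normSq_apply] at this
    linarith
  have h4 : u.im = 0 := by
    rw [h2] at h3
    exact pow_eq_zero_iff two_ne_zero |>.1 (by linarith)
  exact Complex.ext (by simp [h2]) (by simp [h4])

lemma tendsto_cosLog_mul_radius (h0 : 0 < α) {u : ℂ} (hu : 1 + u ∈ Complex.slitPlane) :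
    Tendsto (fun N : ℕ => cosLog α (cosLogRadius α N * u)) atTop (𝓝 (cosLog α u)) := by
  have h1 : Tendsto (fun N : ℕ => (cosLogRadius α N : ℂ) * u) atTop (𝓝 u) := by
    simpa using ((Complex.continuous_ofReal.tendsto 1).comp
      (tendsto_cosLogRadius h0)).mul_const u
  exact (analyticAt_cosLog hu).continuousAt.tendsto.comp h1

lemma exists_norm_inv_cosLog_le (hα : Real.log 2 / Real.pi < α) :
    ∃ C : ℝ, (∀ N : ℕ, 1 ≤ N → ∀ u : ℂ, ‖u‖ = cosLogRadius α N → ‖(cosLog α u)⁻¹‖ ≤ C) ∧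
      (∀ u : ℂ, ‖u‖ = 1 → cosLog α u ≠ 0 ∧ ‖(cosLog α u)⁻¹‖ ≤ C) := by
  have h0 := pos_of_log_two_div_pi_lt hα
  obtain ⟨c, hc, hb⟩ := exists_le_norm_sq_cosLog hα
  have hinv {z : ℂ} (hz : c ≤ ‖z‖ ^ 2) : ‖z⁻¹‖ ≤ max 1 (Real.sqrt c)⁻¹ := by
    refine le_max_of_le_right ?_
    rw [norm_inv]
    exact inv_anti₀ (Real.sqrt_pos.2 hc) (Real.sqrt_le_iff.2 ⟨norm_nonneg z, hz⟩)
  refine ⟨max 1 (Real.sqrt c)⁻¹, fun N hN u hu => hinv (hb N hN u hu), fun u hu => ?_⟩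
  -- At `-1` the default `Complex.log 0 = 0` makes `cosLog` equal 1, whence the `max 1` in the
  -- bound. Elsewhere the bound is a radial limit.
  by_cases hu1 : u = -1
  · simp [hu1, cosLog]
  · have hlim := ((tendsto_cosLog_mul_radius h0
      (one_add_mem_slitPlane_of_norm_eq_one hu hu1)).norm).pow 2
    have hle : c ≤ ‖cosLog α u‖ ^ 2 := by
      refine ge_of_tendsto hlim ?_
      filter_upwards [eventually_ge_atTop 1] with N hN
      refine hb N hN _ ?_
      rw [norm_mul, hu, mul_one, Complex.norm_real, Real.norm_of_nonneg]
      linarith [half_le_cosLogRadius hα hN]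
    refine ⟨fun h => ?_, hinv hle⟩
    rw [h, norm_zero] at hle
    norm_num at hle
    linarith

lemma measurable_cosLog (α : ℝ) : Measurable (cosLog α) := by
  unfold cosLog
  fun_prop

lemma circleMap_zero_eq_mul (R θ : ℝ) : circleMap 0 R θ = R * circleMap 0 1 θ := by
  simp [circleMap]

lemma circleAverage_inv_cosLog_one (hα : Real.log 2 / Real.pi < α) :
    Real.circleAverage (fun u => (cosLog α u)⁻¹) 0 1 =
      ((1 - α / 2 * (sechSum (Real.pi * α) - 1) : ℝ) : ℂ) := by
  have h0 := pos_of_log_two_div_pi_lt hα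
  have hpa : 0 < Real.pi * α := by positivity
  obtain ⟨C, hC, hC1⟩ := exists_norm_inv_cosLog_le hα
  have hlim1 : Tendsto (fun N : ℕ => Real.circleAverage (fun u => (cosLog α u)⁻¹) 0
      (cosLogRadius α N)) atTop (𝓝 (Real.circleAverage (fun u => (cosLog α u)⁻¹) 0 1)) := by
    simp only [Real.circleAverage]
    refine Tendsto.const_smul ?_ _
    refine intervalIntegral.tendsto_integral_filter_of_dominated_convergence (fun _ => C) ?_ ?_
      (by simp) ?_
    · refine Eventually.of_forall fun N => ?_
      exact ((measurable_cosLog α).comp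
        (continuous_circleMap _ _).measurable).inv.aestronglyMeasurable
    · filter_upwards [eventually_ge_atTop 1] with N hN
      refine Eventually.of_forall fun θ _ => hC N hN _ ?_
      rw [norm_circleMap_zero, abs_of_nonneg]
      linarith [half_le_cosLogRadius hα hN]
    -- The angle `π` corresponds to `u = -1`, where the zeros accumulate; it is a null set.
    · have hne : ∀ᵐ θ : ℝ, θ ≠ Real.pi := by
        simp [ae_iff, measure_singleton]
      filter_upwards [hne] with θ hθ hmem
      rw [uIoc_of_le (by positivity)] at hmem
      have hn1 : ‖circleMap 0 1 θ‖ = 1 := by simp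
      have hne1 : circleMap 0 1 θ ≠ -1 := by
        intro h
        have h1 := congrArg Complex.re h
        rw [circleMap_zero, Complex.ofReal_one, one_mul, Complex.exp_ofReal_mul_I_re] at h1
        simp only [Complex.neg_re, Complex.one_re] at h1
        obtain ⟨k, hk⟩ := Real.cos_eq_neg_one_iff.1 h1
        have h2 := hmem.1
        have h3 := hmem.2
        have hk1 : (-1 : ℝ) < k := by
          by_contra hcon
          push Not at hcon
          nlinarith [Real.pi_pos]
        have hk2 : (k : ℝ) < 1 := by
          by_contra hcon
          push Not at hcon
          nlinarith [Real.pi_pos]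
        have hk0 : k = 0 := by
          have a1 : -1 < k := by exact_mod_cast hk1
          have a2 : k < 1 := by exact_mod_cast hk2
          omega
        rw [hk0] at hk
        exact hθ (by simpa using hk.symm)
      have := (tendsto_cosLog_mul_radius h0
        (one_add_mem_slitPlane_of_norm_eq_one hn1 hne1)).inv₀ (hC1 _ hn1).1
      refine this.congr fun N => ?_
      rw [← circleMap_zero_eq_mul]
  have hlim2 : Tendsto (fun N : ℕ => Real.circleAverage (fun u => (cosLog α u)⁻¹) 0
      (cosLogRadius α N)) atTop
      (𝓝 ((1 - 2 * α * ((sechSum (Real.pi * α) - 1) / 4) : ℝ) : ℂ)) := by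
    have h1 := ((hasSum_lambert_sechSum hpa).tendsto_sum_nat.const_mul (2 * α)).const_sub 1
    refine ((Complex.continuous_ofReal.tendsto _).comp h1).congr' ?_
    filter_upwards [eventually_ge_atTop 1] with N hN
    exact (circleAverage_inv_cosLog hα hN).symm
  rw [tendsto_nhds_unique hlim1 hlim2]
  congr 1
  ring

/-! ### Return to the real integral -/

/-- The real part of the reciprocal of the complex cosine. -/
lemma re_inv_cos_add_mul_I (x y : ℝ) :
    ((Complex.cos (x + y * Complex.I))⁻¹).re =
      2 * (Real.cosh y * Real.cos x / (Real.cosh (2 * y) + Real.cos (2 * x))) := by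
  rw [Complex.cos_add_mul_I, Complex.inv_re, Complex.normSq_apply,
    ← Complex.ofReal_cos, ← Complex.ofReal_sin, ← Complex.ofReal_cosh, ← Complex.ofReal_sinh]
  simp only [Complex.sub_re, Complex.sub_im, Complex.mul_re, Complex.mul_im, Complex.ofReal_re,
    Complex.ofReal_im, Complex.I_re, Complex.I_im]
  have h : Real.cosh (2 * y) + Real.cos (2 * x) =
      2 * (Real.cos x ^ 2 * Real.cosh y ^ 2 + Real.sin x ^ 2 * Real.sinh y ^ 2) := by
    rw [Real.cosh_two_mul, Real.cos_two_mul]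
    linear_combination (1 - 2 * Real.cos x ^ 2) * Real.cosh_sq y
      - 2 * Real.sinh y ^ 2 * Real.sin_sq x
  rw [h, mul_div_assoc', mul_div_mul_left _ _ two_ne_zero]
  ring_nf

lemma log_one_add_circleMap {x : ℝ} (hx : x ∈ Ioo (-(Real.pi / 2)) (Real.pi / 2)) :
    Complex.log (1 + circleMap 0 1 (2 * x)) = Real.log (2 * Real.cos x) + x * Complex.I := by
  have hc := Real.cos_pos_of_mem_Ioo hx
  have h1 : 1 + circleMap 0 1 (2 * x) = ((2 * Real.cos x : ℝ) : ℂ) * Complex.exp (x * Complex.I) := by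
    have h2 : Complex.exp (-x * Complex.I) * Complex.exp (x * Complex.I) = 1 := by
      rw [← Complex.exp_add]; simp
    have h3 : Complex.exp (2 * x * Complex.I) =
        Complex.exp (x * Complex.I) * Complex.exp (x * Complex.I) := by
      rw [← Complex.exp_add]; ring_nf
    rw [circleMap_zero]
    push_cast
    rw [Complex.two_cos, h3]
    linear_combination -h2
  have him : ((x : ℂ) * Complex.I).im = x := by simp
  rw [h1, Complex.log_ofReal_mul (by positivity) (Complex.exp_ne_zero _),
    Complex.log_exp (by rw [him]; linarith [hx.1, Real.pi_pos])
      (by rw [him]; linarith [hx.2, Real.pi_pos])]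

/-- The integrand as a real part. -/
lemma re_inv_cosLog_circleMap {x : ℝ} (hx : x ∈ Ioo (-(Real.pi / 2)) (Real.pi / 2)) :
    ((cosLog α (circleMap 0 1 (2 * x)))⁻¹).re =
      2 * (Real.cosh (x / (2 * α)) * Real.cos (Real.log (2 * Real.cos x) / (2 * α)) /
        (Real.cosh (x / α) + Real.cos (Real.log (2 * Real.cos x) / α))) := by
  have h (y : ℝ) : y / α = 2 * (y / (2 * α)) := by
    rw [mul_div_assoc', mul_div_mul_left _ _ two_ne_zero]
  rw [h x, h (Real.log _), ← re_inv_cos_add_mul_I, cosLog, log_one_add_circleMap hx]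
  push_cast
  ring_nf

/-- The bound on the unit circle and measurability suffice; continuity at `u = -1` is not needed. -/
lemma intervalIntegrable_re_inv_cosLog (hα : Real.log 2 / Real.pi < α) (a b : ℝ) :
    IntervalIntegrable (fun x : ℝ => ((cosLog α (circleMap 0 1 (2 * x)))⁻¹).re) volume a b := by
  obtain ⟨C, -, hC⟩ := exists_norm_inv_cosLog_le hα
  refine (intervalIntegrable_const (c := C)).mono_fun ?_ ?_
  · refine Measurable.aestronglyMeasurable ?_
    exact Complex.measurable_re.comp ((measurable_cosLog α).comp
      ((continuous_circleMap _ _).measurable.comp (measurable_const_mul 2))).inv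
  · refine Eventually.of_forall fun x => ?_
    exact (Complex.abs_re_le_norm _).trans ((hC _ (by simp)).2.trans (le_abs_self C))

lemma circleMap_two_mul_pi_sub (x : ℝ) :
    circleMap 0 1 (2 * (Real.pi - x)) = circleMap 0 1 (2 * -x) := by
  rw [show 2 * (Real.pi - x) = 2 * -x + 2 * Real.pi by ring]
  exact periodic_circleMap 0 1 _

lemma integral_re_inv_cosLog (hα : Real.log 2 / Real.pi < α) :
    ∫ x in (0 : ℝ)..(Real.pi / 2), ((cosLog α (circleMap 0 1 (2 * x)))⁻¹).re =
      Real.pi / 2 * (1 - α / 2 * (sechSum (Real.pi * α) - 1)) := by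
  set ψ : ℝ → ℝ := fun x => ((cosLog α (circleMap 0 1 (2 * x)))⁻¹).re with hψ
  have hint := intervalIntegrable_re_inv_cosLog hα
  obtain ⟨C, -, hC⟩ := exists_norm_inv_cosLog_le hα
  have hcint : IntervalIntegrable (fun θ : ℝ => (cosLog α (circleMap 0 1 θ))⁻¹) volume 0
      (2 * Real.pi) := by
    refine (intervalIntegrable_const (c := C)).mono_fun ?_ ?_
    · exact ((measurable_cosLog α).comp (continuous_circleMap _ _).measurable).inv.aestronglyMeasurable
    · refine Eventually.of_forall fun x => ?_
      exact (hC _ (by simp)).2.trans (le_abs_self C)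
  have h1 := congrArg Complex.re (circleAverage_inv_cosLog_one hα)
  rw [Complex.ofReal_re, Real.circleAverage, Complex.smul_re, smul_eq_mul] at h1
  have h2 : (∫ θ in (0 : ℝ)..(2 * Real.pi), (cosLog α (circleMap 0 1 θ))⁻¹).re =
      ∫ θ in (0 : ℝ)..(2 * Real.pi), ((cosLog α (circleMap 0 1 θ))⁻¹).re :=
    (Complex.reCLM.intervalIntegral_comp_comm hcint).symm
  have h3 : ∫ x in (0 : ℝ)..Real.pi, ψ x =
      2⁻¹ * ∫ θ in (0 : ℝ)..(2 * Real.pi), ((cosLog α (circleMap 0 1 θ))⁻¹).re := by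
    have := intervalIntegral.integral_comp_mul_left (a := 0) (b := Real.pi)
      (fun θ : ℝ => ((cosLog α (circleMap 0 1 θ))⁻¹).re) (two_ne_zero (α := ℝ))
    rwa [mul_zero, smul_eq_mul] at this
  -- By `x ↦ π - x`, periodicity and evenness, the quarter period carries half of the full circle
  -- integral.
  have h4 : ∫ x in (Real.pi / 2)..Real.pi, ψ x = ∫ x in (0 : ℝ)..(Real.pi / 2), ψ x := by
    have h5 := intervalIntegral.integral_comp_sub_left (a := 0) (b := Real.pi / 2) ψ Real.pi
    rw [sub_zero, sub_half] at h5
    rw [← h5]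
    refine intervalIntegral.integral_congr_Ioo_of_le (by positivity) fun x hx => ?_
    have hx1 : x ∈ Ioo (-(Real.pi / 2)) (Real.pi / 2) := ⟨by linarith [hx.1, Real.pi_pos], hx.2⟩
    have hx2 : -x ∈ Ioo (-(Real.pi / 2)) (Real.pi / 2) := ⟨by linarith [hx1.2], by linarith [hx1.1]⟩
    simp only [hψ]
    rw [circleMap_two_mul_pi_sub, re_inv_cosLog_circleMap hx1, re_inv_cosLog_circleMap hx2,
      neg_div, neg_div, Real.cosh_neg, Real.cosh_neg, Real.cos_neg]
  have h6 := intervalIntegral.integral_add_adjacent_intervals (hint 0 (Real.pi / 2))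
    (hint (Real.pi / 2) Real.pi)
  rw [h4, h3, ← h2] at h6
  rw [← h1, mul_inv]
  have h7 : Real.pi / 2 * (2⁻¹ * Real.pi⁻¹ * (∫ θ in (0 : ℝ)..(2 * Real.pi),
      (cosLog α (circleMap 0 1 θ))⁻¹).re) = 4⁻¹ * (∫ θ in (0 : ℝ)..(2 * Real.pi),
      (cosLog α (circleMap 0 1 θ))⁻¹).re := by
    generalize (∫ θ in (0 : ℝ)..(2 * Real.pi), (cosLog α (circleMap 0 1 θ))⁻¹).re = w
    field_simp
    ring
  rw [h7]
  change (∫ x in (0 : ℝ)..(Real.pi / 2), ψ x) + _ = _ at h6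
  linarith

end

theorem theorem2 (α : ℝ) (hα : Real.log 2 / Real.pi < α) :
    (∃! k : ℝ, IsModulusFor α k) ∧
    ∀ k : ℝ, IsModulusFor α k →
      IntervalIntegrable
        (fun x : ℝ =>
          Real.cosh (x / (2 * α)) * Real.cos (Real.log (2 * Real.cos x) / (2 * α)) /
            (Real.cosh (x / α) + Real.cos (Real.log (2 * Real.cos x) / α)))
        MeasureTheory.volume 0 (Real.pi / 2) ∧
      ∫ x in (0 : ℝ)..(Real.pi / 2),
          Real.cosh (x / (2 * α)) * Real.cos (Real.log (2 * Real.cos x) / (2 * α)) /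
            (Real.cosh (x / α) + Real.cos (Real.log (2 * Real.cos x) / α))
        = Real.pi / 8 * (α + 2) - α / 4 * ellipticK k := by
  obtain ⟨k₀, hk₀, hK⟩ := exists_isModulusFor (pos_of_log_two_div_pi_lt hα)
  refine ⟨⟨k₀, hk₀, fun l hl => hl.unique hk₀⟩, fun k hk => ?_⟩
  rw [hk.unique hk₀, hK]
  -- The open interval suffices and avoids `x = π/2`, where `cos x = 0`.
  have heq : EqOn (fun x : ℝ => 1 / 2 * ((cosLog α (circleMap 0 1 (2 * x)))⁻¹).re)
      (fun x : ℝ => Real.cosh (x / (2 * α)) * Real.cos (Real.log (2 * Real.cos x) / (2 * α)) /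
        (Real.cosh (x / α) + Real.cos (Real.log (2 * Real.cos x) / α))) (Ioo 0 (Real.pi / 2)) := by
    intro x hx
    simp only []
    rw [re_inv_cosLog_circleMap ⟨by linarith [hx.1, Real.pi_pos], hx.2⟩]
    ring
  constructor
  · have h1 := (intervalIntegrable_re_inv_cosLog hα 0 (Real.pi / 2)).const_mul (1 / 2)
    rw [intervalIntegrable_iff_integrableOn_Ioo_of_le (by positivity)] at h1 ⊢
    exact h1.congr_fun heq measurableSet_Ioo
  · rw [← intervalIntegral.integral_congr_Ioo_of_le (by positivity) heq,
      intervalIntegral.integral_const_mul, integral_re_inv_cosLog hα]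
    ring
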